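/- Conventions. All graphs are finite and undirected, without multiple edges, loops allowed. $N_k$ is the edgeless graph on $k$ vertices, and an embedding is an injective graph homomorphism. For a set $V$ let $\mathbb Z_2^{*V}$ be the free product of copies of $\mathbb Z_2$ with generators $g_v$ ($v\in V$); a map $V\to V'$ induces a homomorphism $\mathbb Z_2^{*V}\to\mathbb Z_2^{*V'}$ denoted by the same letter, and $g_{\mathbf a}=g_{a_1}\cdots g_{a_k}$ for a word $\mathbf a=(a_1,\dots,a_k)$ over $V$. For graphs $K,H$ and an injective partial function $f$ from $V(K)$ to $V(H)$, let $K\cup_f H$ be the quotient of $K\sqcup H$ identifying the pairs in $f$, with inclusions $f_K,f_H$ of the vertex sets. A graph fibration $F$ is a set of pairs $(K,a)$ (up to isomorphism) of a graph $K$ and an element $a\in\mathbb Z_2^{*V(K)}$, containing $(N_0,e)$ and $(N_1,e)$, such that each fibre $F(K)=\{a\mid (K,a)\in F\}$ is empty or a normal subgroup of $\mathbb Z_2^{*V(K)}$ (necessarily $\operatorname{Aut}K$-invariant), and such that $(K,a),(H,b)\in F$ implies $(K\cup_f H,f_K(a)f_H(b))\in F$ for every injective partial function $f$. A graph $K$ is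 contained in $F$ if $F(K)\ne\emptyset$. The corresponding skew graph category $\mathscr C$ consists of the sets $\mathscr C(k,l)$ of all bilabelled graphs $\mathbf K=(K,\mathbf a,\mathbf b)$ with $\mathbf a\in V(K)^k$, $\mathbf b\in V(K)^l$ and $g_{\mathbf a}^{-1}g_{\mathbf b}\in F(K)$. For a graph $G$ with $n$ vertices and a bilabelled graph $\mathbf K=(K,\mathbf a,\mathbf b)\in\mathscr C(k,l)$ let $\hat T^G_{\mathbf K}\colon(\mathbb C^n)^{\otimes k}\to(\mathbb C^n)^{\otimes l}$ be the linear map with entries $$[\hat T^G_{\mathbf K}]_{\mathbf j\mathbf i}=\#\{\text{embeddings }\phi\colon K\to G\mid \phi(\mathbf a)=\mathbf i,\ \phi(\mathbf b)=\mathbf j\},$$ and let $\mathscr C^G(k,l)=\operatorname{span}\{\hat T^G_{\mathbf K}\mid\mathbf K\in\mathscr C(k,l)\}$. An orthogonal compact matrix quantum group is a pair $(A,u)$ of a non-zero unital complex $*$-algebra $A$ and a matrix $u\in M_n(A)$ whose entries are self-adjoint and generate $A$, with $uu^t=1=u^tu$, such that $u_{ij}\mapsto\sum_k u_{ik}\otimes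 u_{kj}$ extends to a $*$-homomorphism $A\to A\otimes A$. Its representation category consists of the spaces $\operatorname{Mor}(u^{\otimes k},u^{\otimes l})=\{T\mid Tu^{\otimes k}=u^{\otimes l}T\}$, $k,l\ge 0$. Two such pairs $(A,u)$, $(B,v)$ are identified if there is a $*$-isomorphism $A\to B$ mapping $u_{ij}$ to $v_{ij}$ for all $i,j$. For a group $\Gamma$ generated by $g_1,\dots,g_n$ and a permutation group $H\subset S_n$ acting on $\Gamma$ by permuting these generators, $\hat\Gamma\rtimes H$ is the pair $(\mathbb C\Gamma\otimes O(H),u)$ with $u_{ij}=g_i\otimes v_{ij}$, where $O(H)$ is the algebra of all functions on $H$ and $v_{ij}(\sigma)=\delta_{i\sigma(j)}$. Theorem. Let $F$ be a graph fibration with corresponding skew graph category $\mathscr C$, and let $G$ be a graph. There is a greatest subgraph $K$ of $G$ contained in $F$, that is, a subgraph $K$ of $G$ contained in $F$ such that every subgraph of $G$ contained in $F$ is a subgraph of $K$. It has the same vertices as $G$. Moreover, $$\hat\Gamma\rtimes\operatorname{Aut}K,\qquad \Gamma=\mathbb Z_2^{*V(K)}/F(K),$$ is the compact matrix quantum group corresponding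 to $\mathscr C^G$: it is an orthogonal compact matrix quantum group with $\operatorname{Mor}(u^{\otimes k},u^{\otimes l})=\mathscr C^G(k,l)$ for all $k,l\ge0$, and it is, up to the above identification, the only one. -/

import Mathlib

open scoped TensorProduct

universe u w

noncomputable section

/-! ### Graphs -/

/-- An undirected graph on the vertex set `V`, without multiple edges, loops allowed.
(Finiteness of `V` is assumed where graphs are used.) -/
@[ext]
structure LGraph (V : Type*) where
  Adj : V → V → Prop
  symm : ∀ x y, Adj x y → Adj y x

namespace LGraph

/-- The graph on `V` without edges. -/
def edgeless (V : Type*) : LGraph V where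
  Adj _ _ := False
  symm _ _ h := h

/-- Injective graph homomorphisms. -/
structure IsEmbedding {V W : Type*} (K : LGraph V) (G : LGraph W) (φ : V → W) : Prop where
  injective : Function.Injective φ
  map_adj : ∀ x y, K.Adj x y → G.Adj (φ x) (φ y)

/-- The group of automorphisms of a graph, as a permutation group of the vertices. -/
def aut {V : Type*} (K : LGraph V) : Subgroup (Equiv.Perm V) where
  carrier := {σ | ∀ x y, K.Adj (σ x) (σ y) ↔ K.Adj x y}
  one_mem' := fun _ _ => Iff.rfl
  mul_mem' := fun {σ τ} hσ hτ x y => (hσ (τ x) (τ y)).trans (hτ x y)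
  inv_mem' := fun {σ} hσ x y => by
    have h := hσ (σ⁻¹ x) (σ⁻¹ y)
    simpa using h.symm

end LGraph

/-- A vertex overlap: an injective partial function from `V` to `W`, given by its graph. -/
structure VertexOverlap (V W : Type*) where
  rel : V → W → Prop
  right_unique : ∀ v w w', rel v w → rel v w' → w = w'
  left_unique : ∀ v v' w, rel v w → rel v' w → v = v'

namespace VertexOverlap

variable {V W : Type*} (f : VertexOverlap V W)

/-- The vertex set of an `f`-union: the disjoint union with all the pairs in `f` identified. -/
def UnionVertex : Type _ :=
  Quot fun x y : V ⊕ W => ∃ v w, f.rel v w ∧ x = Sum.inl v ∧ y = Sum.inr w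

instance [Finite V] [Finite W] : Finite f.UnionVertex := Quot.finite _

/-- The inclusion of the first vertex set. -/
def inl (v : V) : f.UnionVertex := Quot.mk _ (Sum.inl v)

/-- The inclusion of the second vertex set. -/
def inr (w : W) : f.UnionVertex := Quot.mk _ (Sum.inr w)

/-- The `f`-union of two graphs: two vertices are adjacent if some representatives are. -/
def union (K : LGraph V) (H : LGraph W) : LGraph f.UnionVertex where
  Adj p q :=
    (∃ v v', K.Adj v v' ∧ p = f.inl v ∧ q = f.inl v') ∨
      (∃ w w', H.Adj w w' ∧ p = f.inr w ∧ q = f.inr w')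
  symm p q h := by
    rcases h with ⟨v, v', h, hp, hq⟩ | ⟨w, w', h, hp, hq⟩
    · exact Or.inl ⟨v', v, K.symm _ _ h, hq, hp⟩
    · exact Or.inr ⟨w', w, H.symm _ _ h, hq, hp⟩

end VertexOverlap

/-! ### Free products of copies of `ℤ/2` -/

/-- The free product of copies of the group `ℤ/2`, one for each element of `V`. -/
abbrev FreeProdZ2 (V : Type*) : Type _ :=
  Monoid.CoprodI fun _ : V => Multiplicative (ZMod 2)

namespace FreeProdZ2

/-- The generator (of order two) of the factor belonging to `v`. -/
def gen {V : Type*} (v : V) : FreeProdZ2 V :=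
  Monoid.CoprodI.of (M := fun _ : V => Multiplicative (ZMod 2)) (i := v)
    (Multiplicative.ofAdd (1 : ZMod 2))

/-- The homomorphism induced by a map of the index sets; it sends generators to generators. -/
def map {V W : Type*} (φ : V → W) : FreeProdZ2 V →* FreeProdZ2 W :=
  Monoid.CoprodI.lift fun v =>
    Monoid.CoprodI.of (M := fun _ : W => Multiplicative (ZMod 2)) (i := φ v)

/-- The group element `g_a = g_{a₁} ⋯ g_{a_k}` represented by the word `a = a₁ ⋯ a_k`. -/
def word {V : Type*} {k : ℕ} (a : Fin k → V) : FreeProdZ2 V :=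
  (List.ofFn fun r => gen (a r)).prod

end FreeProdZ2

/-! ### Graph fibrations and the associated categories of bilabelled graphs -/

/-- A graph fibration `F`. It is a set of pairs `(K, a)`, where `K` is a finite graph and
`a` is an element of the free product of copies of `ℤ/2` indexed by the vertices of `K`; such pairs
are considered up to isomorphism (`iso_mem`; the case of an automorphism of `K` says that the fibre
of `K` is invariant under automorphisms). The set is given by its fibres `F(K)`. -/
structure GraphFibration where
  /-- The fibre `F(K) = {a | (K, a) ∈ F}`. -/
  fibre : ∀ {V : Type u} [Finite V], LGraph V → Set (FreeProdZ2 V)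
  iso_mem : ∀ {V W : Type u} [Finite V] [Finite W] (K : LGraph V) (H : LGraph W) (e : V ≃ W),
    (∀ x y, K.Adj x y ↔ H.Adj (e x) (e y)) → ∀ a ∈ fibre K, FreeProdZ2.map e a ∈ fibre H
  null_mem : 1 ∈ fibre (LGraph.edgeless PEmpty.{u + 1})
  single_mem : 1 ∈ fibre (LGraph.edgeless PUnit.{u + 1})
  empty_or_normal : ∀ {V : Type u} [Finite V] (K : LGraph V),
    fibre K = ∅ ∨ ∃ N : Subgroup (FreeProdZ2 V), N.Normal ∧ (N : Set (FreeProdZ2 V)) = fibre K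
  union_mem : ∀ {V W : Type u} [Finite V] [Finite W] (K : LGraph V) (H : LGraph W)
    (f : VertexOverlap V W), ∀ a ∈ fibre K, ∀ b ∈ fibre H,
      FreeProdZ2.map f.inl a * FreeProdZ2.map f.inr b ∈ fibre (f.union K H)

/-- A bilabelled graph with `k` input and `l` output vertices. -/
structure BilabelledGraph (k l : ℕ) where
  /-- The vertex set. -/
  V : Type u
  finite : Finite V
  graph : LGraph V
  inp : Fin k → V
  out : Fin l → V

attribute [instance] BilabelledGraph.finite

namespace GraphFibration

variable (F : GraphFibration.{u})

/-- The graph `K` is contained in `F`: its fibre is non-empty. -/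
def Contains {V : Type u} [Finite V] (K : LGraph V) : Prop := (F.fibre K).Nonempty

/-- The fibre `F(K)` as a normal subgroup. (The normal closure only serves to have a total
definition: for `K` contained in `F` the fibre is itself a normal subgroup, see
`coe_fibreSubgroup`.) -/
def fibreSubgroup {V : Type u} [Finite V] (K : LGraph V) : Subgroup (FreeProdZ2 V) :=
  Subgroup.normalClosure (F.fibre K)

instance {V : Type u} [Finite V] (K : LGraph V) : (F.fibreSubgroup K).Normal :=
  Subgroup.normalClosure_normal

theorem coe_fibreSubgroup {V : Type u} [Finite V] (K : LGraph V) (hK : F.Contains K) :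
    (F.fibreSubgroup K : Set (FreeProdZ2 V)) = F.fibre K := by
  rcases F.empty_or_normal K with h | ⟨N, hN, h⟩
  · exact absurd hK (by simp [Contains, h])
  · rw [fibreSubgroup, ← h, Subgroup.normalClosure_eq_self]

/-- The group `Γ = ℤ/2^{*V(K)} / F(K)`. -/
abbrev FibreQuotient {V : Type u} [Finite V] (K : LGraph V) : Type u :=
  FreeProdZ2 V ⧸ F.fibreSubgroup K

/-- The generators of `Γ = ℤ/2^{*V(K)} / F(K)`, indexed by the vertices of `K`. -/
def quotientGen {V : Type u} [Finite V] (K : LGraph V) (x : V) : F.FibreQuotient K :=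
  (FreeProdZ2.gen x : FreeProdZ2 V ⧸ F.fibreSubgroup K)

/-- The skew graph category corresponding to `F`: all bilabelled graphs `(K, a, b)`
with `g_a⁻¹ g_b ∈ F(K)`. -/
def category (k l : ℕ) : Set (BilabelledGraph.{u} k l) :=
  {K | (FreeProdZ2.word K.inp)⁻¹ * FreeProdZ2.word K.out ∈ F.fibre K.graph}

/-- `K`, embedded into `G` by `ι`, is the greatest subgraph of `G` contained in `F`: it is contained
in `F`, and every subgraph of `G` contained in `F` (the image of an embedding `φ : H → G`) is a
subgraph of the image of `K`. -/
structure IsGreatestSubgraph {V W : Type u} [Finite W] (G : LGraph V) (K : LGraph W)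
    (ι : W → V) : Prop where
  contains : F.Contains K
  isEmbedding : K.IsEmbedding G ι
  greatest : ∀ {U : Type u} [Finite U] (H : LGraph U) (φ : U → V), F.Contains H →
    H.IsEmbedding G φ → ∃ ψ : U → W, H.IsEmbedding K ψ ∧ ∀ x, ι (ψ x) = φ x

end GraphFibration

/-- The linear map from the `k`-th to the `l`-th tensor power of `ℂ^V` given by the numbers of
injective homomorphisms of a bilabelled graph into `G`. Linear maps are represented by their
matrices, the entry at `(j, i)` is the coefficient of `e_{j₁} ⊗ ⋯ ⊗ e_{j_l}` in the image of
`e_{i₁} ⊗ ⋯ ⊗ e_{i_k}`. -/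
def hatT {V : Type u} (G : LGraph V) {k l : ℕ} (K : BilabelledGraph.{u} k l) :
    Matrix (Fin l → V) (Fin k → V) ℂ :=
  fun j i => (Nat.card {φ : K.V → V //
    K.graph.IsEmbedding G φ ∧ φ ∘ K.inp = i ∧ φ ∘ K.out = j} : ℂ)

/-- The morphism spaces of the representation category associated to a category `C` of bilabelled
graphs and a graph `G`. -/
def repCategory (C : ∀ k l : ℕ, Set (BilabelledGraph.{u} k l)) {V : Type u} (G : LGraph V)
    (k l : ℕ) : Submodule ℂ (Matrix (Fin l → V) (Fin k → V) ℂ) :=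
  Submodule.span ℂ (hatT G '' C k l)

/-! ### Orthogonal compact matrix quantum groups -/

section QuantumGroup

variable {n : Type*} {A : Type*} [Ring A] [Algebra ℂ A]

/-- `(A, u)` is an orthogonal compact matrix quantum group: `A` is a (non-zero, unital) `*`-algebra
generated by the entries of `u`, the matrix `u` is orthogonal with self-adjoint entries, and
`u i j ↦ ∑ k, u i k ⊗ u k j` extends to a `*`-homomorphism. -/
structure IsOrthogonalCMQG [Fintype n] [DecidableEq n] [StarRing A] [StarModule ℂ A]
    (u : Matrix n n A) : Prop where
  nontrivial : Nontrivial A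
  generates : StarAlgebra.adjoin ℂ {a : A | ∃ i j, a = u i j} = ⊤
  isSelfAdjoint : ∀ i j, IsSelfAdjoint (u i j)
  mul_transpose : u * u.transpose = 1
  transpose_mul : u.transpose * u = 1
  exists_comul : ∃ Δ : A →⋆ₐ[ℂ] A ⊗[ℂ] A, ∀ i j, Δ (u i j) = ∑ k, u i k ⊗ₜ[ℂ] u k j

/-- The tensor power `u^{⊗k}`, with entries `u_{i₁ j₁} ⋯ u_{i_k j_k}`. -/
def tensorPow (u : Matrix n n A) (k : ℕ) : Matrix (Fin k → n) (Fin k → n) A :=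
  fun i j => (List.ofFn fun r => u (i r) (j r)).prod

/-- The intertwiner space `Mor(u^{⊗k}, u^{⊗l})`, that is, all `T` with `T u^{⊗k} = u^{⊗l} T`. -/
def Mor [Fintype n] (u : Matrix n n A) (k l : ℕ) :
    Submodule ℂ (Matrix (Fin l → n) (Fin k → n) ℂ) where
  carrier := {T | T.map (algebraMap ℂ A) * tensorPow u k =
    tensorPow u l * T.map (algebraMap ℂ A)}
  zero_mem' := by simp
  add_mem' := by
    intro S T hS hT
    simp only [Set.mem_ofPred_eq] at hS hT ⊢
    rw [Matrix.map_add _ (map_add _), Matrix.add_mul, Matrix.mul_add, hS, hT]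
  smul_mem' := by
    intro c T hT
    simp only [Set.mem_ofPred_eq] at hT ⊢
    have h : (c • T).map (algebraMap ℂ A) = c • T.map (algebraMap ℂ A) := by
      ext i j
      simp [Algebra.smul_def]
    rw [h, Matrix.smul_mul, Matrix.mul_smul, hT]

/-- `(A, u)` is an orthogonal compact matrix quantum group with representation category `R`. -/
structure HasRepCategory [Fintype n] [DecidableEq n] [StarRing A] [StarModule ℂ A]
    (u : Matrix n n A) (R : ∀ k l : ℕ, Submodule ℂ (Matrix (Fin l → n) (Fin k → n) ℂ)) :
    Prop where
  isOrthogonalCMQG : IsOrthogonalCMQG u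
  mor_eq : ∀ k l, Mor u k l = R k l

end QuantumGroup

/-! ### Semidirect products -/

namespace GroupStarAlgebra

variable {Γ : Type*} [Group Γ]

/-- The involution of the complex group algebra, `(∑ c_g g)^* = ∑ \bar c_g g⁻¹`. -/
instance : Star (MonoidAlgebra ℂ Γ) where
  star x := MonoidAlgebra.ofCoeff
    ((x.coeff.mapRange (starRingEnd ℂ) (map_zero _)).mapDomain fun g => g⁻¹)

theorem coeff_star (x : MonoidAlgebra ℂ Γ) : (star x).coeff =
    (x.coeff.mapRange (starRingEnd ℂ) (map_zero _)).mapDomain fun g => g⁻¹ := rfl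

theorem star_single (g : Γ) (c : ℂ) :
    star (MonoidAlgebra.single g c) = MonoidAlgebra.single g⁻¹ (star c) := by
  apply MonoidAlgebra.coeff_injective
  simp [coeff_star]

theorem star_add' (x y : MonoidAlgebra ℂ Γ) : star (x + y) = star x + star y := by
  apply MonoidAlgebra.coeff_injective
  simp [coeff_star, Finsupp.mapRange_add, Finsupp.mapDomain_add]

theorem star_zero' : star (0 : MonoidAlgebra ℂ Γ) = 0 := by
  simpa using star_single (1 : Γ) 0

instance : StarRing (MonoidAlgebra ℂ Γ) where
  star_involutive x := by
    induction x using MonoidAlgebra.induction_linear with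
    | zero => rw [star_zero', star_zero']
    | add x y hx hy => rw [star_add', star_add', hx, hy]
    | single g c => rw [star_single, star_single, inv_inv, star_star]
  star_mul x y := by
    induction x using MonoidAlgebra.induction_linear with
    | zero => rw [zero_mul, star_zero', mul_zero]
    | add x x' hx hx' => rw [add_mul, star_add', star_add', mul_add, hx, hx']
    | single g c =>
      induction y using MonoidAlgebra.induction_linear with
      | zero => rw [mul_zero, star_zero', zero_mul]
      | add y y' hy hy' => rw [mul_add, star_add', star_add', add_mul, hy, hy']
      | single h d =>
        rw [MonoidAlgebra.single_mul_single, star_single, star_single, star_single,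
          MonoidAlgebra.single_mul_single, mul_inv_rev, star_mul]
  star_add := star_add'

instance : StarModule ℂ (MonoidAlgebra ℂ Γ) where
  star_smul c x := by
    induction x using MonoidAlgebra.induction_linear with
    | zero => rw [smul_zero, star_zero, smul_zero]
    | add x y hx hy => rw [smul_add, star_add, star_add, smul_add, hx, hy]
    | single g d =>
      rw [MonoidAlgebra.smul_single, star_single, star_single, MonoidAlgebra.smul_single,
        smul_eq_mul, smul_eq_mul, star_mul']

end GroupStarAlgebra

/-- The algebra `ℂΓ ⊗ O(H)` of the semidirect product of the dual of `Γ` and a finite group `H`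
(where `O(H)` consists of all functions on `H`). -/
abbrev SemidirectAlgebra (Γ : Type*) [Group Γ] (H : Type*) : Type _ :=
  MonoidAlgebra ℂ Γ ⊗[ℂ] (H → ℂ)

/-- The fundamental representation `u = γ v` of the semidirect product of the dual of the group `Γ`,
generated by the elements `g i`, and a permutation group `H`: its entries are
`u i j = γ i ⊗ v i j`, where `γ i` is the element `g i` of the group algebra and
`v i j` is the function `σ ↦ δ_{i, σ j}` on `H`. -/
def semidirectRep {W : Type*} [DecidableEq W] {Γ : Type*} [Group Γ] (g : W → Γ)
    (H : Subgroup (Equiv.Perm W)) : Matrix W W (SemidirectAlgebra Γ H) :=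
  fun i j => MonoidAlgebra.single (g i) 1 ⊗ₜ[ℂ] fun σ => if i = (σ : Equiv.Perm W) j then 1 else 0

/-- The fundamental representation of the semidirect product of the dual of
`Γ = ℤ/2^{*V(K)} / F(K)` and `Aut K`. -/
def GraphFibration.fundamentalRep (F : GraphFibration.{u}) {W : Type u} [Finite W]
    [DecidableEq W] (K : LGraph W) : Matrix W W (SemidirectAlgebra (F.FibreQuotient K) K.aut) :=
  semidirectRep (F.quotientGen K) K.aut

end

/-! The graphs in `F` are closed under unions inside a common vertex set
(`GraphFibration.Contains.supImage`), and all edgeless graphs are among them. Hence a subgraph of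
`G` in `F` on all vertices with a maximal edge set absorbs every other subgraph in `F`: it is the
greatest one, `K`. Embeddings of graphs in `F` into `G` are the same as embeddings into `K`, so `G`
may be replaced by `K` (`mem_repCategory_iff`).

For `K` in `F`, both sides equal one explicit space, `semidirectMor`: the `Aut K`-invariant matrices
whose entry at `(m, j)` vanishes unless `g_m = g_j` in `Γ`. It is spanned by orbit matrices, and
these count embeddings of a labelled copy of `K` into itself, which are its automorphisms
(`repCategory_eq_semidirectMor`). For the semidirect product, the intertwiner equation is compared
coefficientwise in the basis `γ ⊗ δ_σ` (`mor_semidirectRep`).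

Uniqueness is obtained by a direct argument in place of Tannaka–Krein duality. Let `v` have these
intertwiners. A word `a` using every letter has trivial stabiliser in `H`, so the relations given by
orbit matrices show that the entry of a tensor power of `v` at `(a, σ⁻¹ ∘ a)` depends only on `g_a`
and `σ`. These entries multiply like the `γ ⊗ δ_σ`, which yields a homomorphism `Φ` onto the algebra
of `v` (`exists_starAlgHom`). It is injective because any collapse would create a fixed vector of
some tensor power of `v` outside `semidirectMor`; beyond that, the linear independence of group-like
elements suffices (`injective_of_mor_eq`). -/

noncomputable section

/-! ### Linear independence of group-like elements -/

section GroupLike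

variable {k M N ι : Type*} [Field k] [AddCommGroup M] [Module k M] [AddCommGroup N] [Module k N]

theorem LinearIndepOn.eq_zero_of_sum_tmul_eq_zero {x : ι → M} {s : Finset ι}
    (hx : LinearIndepOn k x s) (y : ι → N) (h : ∑ i ∈ s, x i ⊗ₜ[k] y i = 0) :
    ∀ i ∈ s, y i = 0 := by
  classical
  intro i hi
  -- `f` extends the `i`-th coordinate functional on the span to all of `M`; applying `f ⊗ id` to
  -- the relation isolates `y i`.
  obtain ⟨f, hf⟩ := LinearMap.exists_extend
    ((Finsupp.lapply (R := k) (M := k) (⟨i, hi⟩ : (s : Set ι))) ∘ₗ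
      LinearIndependent.repr hx)
  have hfx : ∀ j (hj : j ∈ s), f (x j) = if j = i then 1 else 0 := by
    intro j hj
    have hmem : x j ∈ Submodule.span k (Set.range fun l : (s : Set ι) => x l) :=
      Submodule.subset_span ⟨⟨j, hj⟩, rfl⟩
    have h1 := LinearMap.congr_fun hf ⟨x j, hmem⟩
    have h2 := hx.repr_eq_single ⟨j, hj⟩ ⟨x j, hmem⟩ rfl
    simp only [LinearMap.comp_apply, Submodule.subtype_apply] at h1
    rw [h1, h2]
    simp [Finsupp.single_apply]
  have h3 := congrArg ((TensorProduct.lid k N).toLinearMap ∘ₗ LinearMap.rTensor N f) h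
  simp only [map_sum, LinearMap.comp_apply, LinearMap.rTensor_tmul, LinearEquiv.coe_coe,
    TensorProduct.lid_tmul, map_zero] at h3
  rw [Finset.sum_eq_single_of_mem i hi (fun j hj hji => by simp [hfx j hj, hji])] at h3
  simpa [hfx i hi] using h3

/-- The classical argument for group-like elements: if `x a = ∑ d i • x i` with the `x i`
independent, then expanding `x a ⊗ x a` once directly and once through `D` gives `d i • (x a - x i)
= 0`. Distinctness forces all `d i = 0`, hence `x a = 0`. -/
theorem linearIndependent_of_map_eq_tmul_self (D : M →ₗ[k] M ⊗[k] M) {x : ι → M}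
    (hinj : Function.Injective x) (h0 : ∀ i, x i ≠ 0) (hD : ∀ i, D (x i) = x i ⊗ₜ x i) :
    LinearIndependent k x := by
  classical
  rw [linearIndependent_iff']
  intro s
  induction s using Finset.induction_on with
  | empty => simp
  | insert a s ha ih =>
    intro c hc
    have hs : LinearIndepOn k x s := by
      rw [linearIndepOn_finset_iff]
      exact ih
    have hca : c a = 0 := by
      by_contra hca
      rw [Finset.sum_insert ha] at hc
      have hxa : x a = ∑ i ∈ s, (-(c a)⁻¹ * c i) • x i := by
        simp_rw [mul_smul, ← Finset.smul_sum]
        rw [eq_neg_of_add_eq_zero_right hc, smul_neg, neg_smul, neg_neg, inv_smul_smul₀ hca]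
      set d : ι → k := fun i => -(c a)⁻¹ * c i
      have h1 : ∑ i ∈ s, x i ⊗ₜ[k] (d i • (x a - x i)) = 0 := by
        have h2 : x a ⊗ₜ[k] x a = ∑ i ∈ s, x i ⊗ₜ[k] (d i • x a) := by
          conv_lhs => lhs; rw [hxa]
          rw [TensorProduct.sum_tmul]
          simp_rw [TensorProduct.smul_tmul]
          rfl
        have h3 : x a ⊗ₜ[k] x a = ∑ i ∈ s, x i ⊗ₜ[k] (d i • x i) := by
          rw [← hD, hxa, map_sum]
          simp_rw [map_smul, hD, TensorProduct.tmul_smul]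
          rfl
        simp_rw [smul_sub, TensorProduct.tmul_sub, Finset.sum_sub_distrib]
        rw [← h2, ← h3, sub_self]
      have h4 := hs.eq_zero_of_sum_tmul_eq_zero _ h1
      apply h0 a
      rw [hxa]
      refine Finset.sum_eq_zero fun i hi => ?_
      rcases smul_eq_zero.1 (h4 i hi) with h | h
      · change d i • x i = 0
        rw [h, zero_smul]
      · exact absurd (hinj (sub_eq_zero.1 h) ▸ hi) ha
    rw [Finset.sum_insert ha, hca, zero_smul, zero_add] at hc
    intro i hi
    rcases Finset.mem_insert.1 hi with rfl | hi
    · exact hca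
    · exact ih c hc i hi

end GroupLike

/-! ### Words and tensor powers -/

section Words

variable {W Γ : Type*} [Group Γ]

/-- The product `g_{m₁} ⋯ g_{m_k}`. -/
def wordProd (g : W → Γ) {k : ℕ} (m : Fin k → W) : Γ := (List.ofFn fun r => g (m r)).prod

theorem wordProd_append (g : W → Γ) {k l : ℕ} (m : Fin k → W) (m' : Fin l → W) :
    wordProd g (Fin.append m m') = wordProd g m * wordProd g m' := by
  have h : (fun r => g (Fin.append m m' r)) = Fin.append (g ∘ m) (g ∘ m') := by
    ext r
    refine Fin.addCases (fun r => ?_) (fun r => ?_) r <;> simp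
  rw [wordProd, h, List.ofFn_fin_append, List.prod_append]
  rfl

theorem wordProd_cons (g : W → Γ) {k : ℕ} (x : W) (m : Fin k → W) :
    wordProd g (Fin.cons x m : Fin (k + 1) → W) = g x * wordProd g m := by
  simp [wordProd, List.ofFn_succ]

theorem wordProd_zero (g : W → Γ) (m : Fin 0 → W) : wordProd g m = 1 := by
  simp [wordProd]

theorem map_wordProd {Γ' : Type*} [Group Γ'] (f : Γ →* Γ') (g : W → Γ) {k : ℕ} (m : Fin k → W) :
    f (wordProd g m) = wordProd (f ∘ g) m := by
  rw [wordProd, map_list_prod, List.map_ofFn]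
  rfl

theorem ofFn_comp_rev {α : Type*} {k : ℕ} (f : Fin k → α) :
    List.ofFn (fun r => f r.rev) = (List.ofFn f).reverse := by
  apply List.ext_getElem
  · simp
  · intro i h1 h2
    simp only [List.getElem_ofFn, List.getElem_reverse, List.length_ofFn]
    congr 1
    ext
    simp [Fin.rev]
    omega

theorem wordProd_rev (g : W → Γ) (hg : ∀ x, g x * g x = 1) {k : ℕ} (m : Fin k → W) :
    wordProd g (fun r => m r.rev) = (wordProd g m)⁻¹ := by
  rw [wordProd, ofFn_comp_rev fun r => g (m r), wordProd, List.prod_inv_reverse, List.map_ofFn]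
  congr 3
  ext r
  exact (inv_eq_of_mul_eq_one_left (hg _)).symm

variable {n A : Type*} [Ring A]

theorem tensorPow_append (u : Matrix n n A) {k l : ℕ} (i j : Fin k → n) (i' j' : Fin l → n) :
    tensorPow u (k + l) (Fin.append i i') (Fin.append j j') =
      tensorPow u k i j * tensorPow u l i' j' := by
  have h : (fun r => u (Fin.append i i' r) (Fin.append j j' r)) =
      Fin.append (fun r => u (i r) (j r)) (fun r => u (i' r) (j' r)) := by
    ext r
    refine Fin.addCases (fun r => ?_) (fun r => ?_) r <;> simp
  rw [tensorPow, h, List.ofFn_fin_append, List.prod_append]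
  rfl

theorem tensorPow_cons (u : Matrix n n A) {k : ℕ} (x y : n) (i j : Fin k → n) :
    tensorPow u (k + 1) (Fin.cons x i : Fin (k + 1) → n) (Fin.cons y j : Fin (k + 1) → n) =
      u x y * tensorPow u k i j := by
  simp [tensorPow, List.ofFn_succ]

theorem tensorPow_succ (u : Matrix n n A) {k : ℕ} (i j : Fin (k + 1) → n) :
    tensorPow u (k + 1) i j = u (i 0) (j 0) * tensorPow u k (Fin.tail i) (Fin.tail j) := by
  simp [tensorPow, List.ofFn_succ, Fin.tail]

theorem tensorPow_zero (u : Matrix n n A) (i j : Fin 0 → n) : tensorPow u 0 i j = 1 := by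
  simp [tensorPow]

theorem tensorPow_rev [StarRing A] (u : Matrix n n A) (hu : ∀ i j, IsSelfAdjoint (u i j)) {k : ℕ}
    (i j : Fin k → n) :
    star (tensorPow u k i j) = tensorPow u k (fun r => i r.rev) (fun r => j r.rev) := by
  have h : ∀ L : List A, (∀ x ∈ L, IsSelfAdjoint x) → star L.prod = L.reverse.prod := by
    intro L hL
    induction L with
    | nil => simp
    | cons x L ih =>
      rw [List.prod_cons, star_mul, ih fun y hy => hL y (List.mem_cons_of_mem _ hy),
        hL x List.mem_cons_self, List.reverse_cons, List.prod_append, List.prod_singleton]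
  unfold tensorPow
  rw [ofFn_comp_rev fun r => u (i r) (j r)]
  refine h _ fun x hx => ?_
  obtain ⟨r, rfl⟩ := List.mem_ofFn.1 hx
  exact hu _ _

theorem mem_Mor_iff [Algebra ℂ A] [Fintype n] (u : Matrix n n A) {k l : ℕ}
    (T : Matrix (Fin l → n) (Fin k → n) ℂ) :
    T ∈ Mor u k l ↔ ∀ m j, ∑ p, T m p • tensorPow u k p j = ∑ p, T p j • tensorPow u l m p := by
  change T.map (algebraMap ℂ A) * tensorPow u k = tensorPow u l * T.map (algebraMap ℂ A) ↔ _
  rw [← Matrix.ext_iff]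
  refine forall₂_congr fun m j => ?_
  simp only [Matrix.mul_apply, Matrix.map_apply, Algebra.smul_def, Algebra.commutes]

end Words

/-! ### Groups generated by permuted involutions -/

section PermutedInvolutions

variable {W : Type*} {Γ : Type*} [Group Γ]

/-- The group `Γ` is generated by the involutions `g x`, and each element `σ` of the permutation
group `H` induces an endomorphism of `Γ` mapping `g x` to `g (σ x)`. -/
structure PermutesInvolutions (g : W → Γ) (H : Subgroup (Equiv.Perm W)) (act : H → Γ →* Γ) :
    Prop where
  mul_self : ∀ x, g x * g x = 1
  closure_eq_top : Subgroup.closure (Set.range g) = ⊤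
  act_gen : ∀ σ x, act σ (g x) = g ((σ : Equiv.Perm W) x)

namespace PermutesInvolutions

variable {g : W → Γ} {H : Subgroup (Equiv.Perm W)} {act : H → Γ →* Γ}
  (h : PermutesInvolutions g H act)

include h

theorem act_wordProd (σ : H) {k : ℕ} (m : Fin k → W) :
    act σ (wordProd g m) = wordProd g ((σ : Equiv.Perm W) ∘ m) := by
  rw [map_wordProd]
  simp only [wordProd, Function.comp_apply, h.act_gen]

/-- That `act` is a group action need not be assumed, since it is prescribed on generators. -/
theorem act_mul (σ τ : H) (γ : Γ) : act (σ * τ) γ = act σ (act τ γ) := by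
  have h1 : act (σ * τ) = (act σ).comp (act τ) := by
    refine MonoidHom.eq_of_eqOn_dense h.closure_eq_top ?_
    rintro _ ⟨x, rfl⟩
    simp [h.act_gen]
  rw [h1, MonoidHom.comp_apply]

theorem act_one (γ : Γ) : act 1 γ = γ := by
  have h1 : act 1 = MonoidHom.id Γ := by
    refine MonoidHom.eq_of_eqOn_dense h.closure_eq_top ?_
    rintro _ ⟨x, rfl⟩
    simp [h.act_gen]
  rw [h1, MonoidHom.id_apply]

theorem exists_wordProd_eq (γ : Γ) : ∃ (k : ℕ) (m : Fin k → W), wordProd g m = γ := by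
  have hγ : γ ∈ Subgroup.closure (Set.range g) := h.closure_eq_top ▸ Subgroup.mem_top γ
  induction hγ using Subgroup.closure_induction with
  | mem x hx =>
    obtain ⟨y, rfl⟩ := hx
    exact ⟨1, fun _ => y, by simp [wordProd]⟩
  | one => exact ⟨0, Fin.elim0, by simp [wordProd]⟩
  | mul x y _ _ hx hy =>
    obtain ⟨k, m, rfl⟩ := hx
    obtain ⟨l, m', rfl⟩ := hy
    exact ⟨k + l, Fin.append m m', wordProd_append g m m'⟩
  | inv x _ hx =>
    obtain ⟨k, m, rfl⟩ := hx
    exact ⟨k, fun r => m r.rev, wordProd_rev g h.mul_self m⟩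

/-- A word is padded with a listing of all letters followed by its reverse, which cancels because
the generators are involutions. Surjective words matter because no nontrivial element of `H` fixes
them. -/
theorem exists_surjective_wordProd_eq [Finite W] (γ : Γ) :
    ∃ (k : ℕ) (m : Fin k → W), Function.Surjective m ∧ wordProd g m = γ := by
  obtain ⟨n, ⟨e⟩⟩ := Finite.exists_equiv_fin W
  obtain ⟨k, m, hm⟩ := h.exists_wordProd_eq γ
  refine ⟨n + n + k, Fin.append (Fin.append e.symm fun r => e.symm r.rev) m, fun x => ?_, ?_⟩
  · exact ⟨Fin.castAdd k (Fin.castAdd n (e x)), by simp⟩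
  · rw [wordProd_append, wordProd_append, wordProd_rev g h.mul_self, mul_inv_cancel, one_mul, hm]

end PermutesInvolutions

end PermutedInvolutions

/-! ### The intertwiner spaces of the semidirect product -/

section SemidirectMor

variable {W : Type*} {Γ : Type*} [Group Γ] (g : W → Γ) (H : Subgroup (Equiv.Perm W))

/-- The `H`-invariant matrices whose non-vanishing entries are in positions given by pairs of words
representing the same element of `Γ`. -/
def semidirectMor (k l : ℕ) : Submodule ℂ (Matrix (Fin l → W) (Fin k → W) ℂ) where
  carrier := {T | (∀ σ : H, ∀ m j,
    T ((σ : Equiv.Perm W) ∘ m) ((σ : Equiv.Perm W) ∘ j) = T m j) ∧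
      ∀ m j, T m j ≠ 0 → wordProd g m = wordProd g j}
  zero_mem' := by simp
  add_mem' := by
    rintro S T ⟨hS, hS'⟩ ⟨hT, hT'⟩
    refine ⟨fun σ m j => by simp [hS, hT], fun m j hST => ?_⟩
    by_cases h : S m j = 0
    · exact hT' m j fun h' => hST (by simp [h, h'])
    · exact hS' m j h
  smul_mem' := by
    rintro c T ⟨hT, hT'⟩
    exact ⟨fun σ m j => by simp [hT], fun m j hcT => hT' m j fun h' => hcT (by simp [h'])⟩

theorem mem_semidirectMor {k l : ℕ} {T : Matrix (Fin l → W) (Fin k → W) ℂ} :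
    T ∈ semidirectMor g H k l ↔ (∀ σ : H, ∀ m j,
      T ((σ : Equiv.Perm W) ∘ m) ((σ : Equiv.Perm W) ∘ j) = T m j) ∧
        ∀ m j, T m j ≠ 0 → wordProd g m = wordProd g j := Iff.rfl

variable [DecidableEq W] [Fintype H]

/-- The matrix counting the elements of `H` mapping a given pair of words to another one. -/
def orbitMatrix {k l : ℕ} (a : Fin l → W) (b : Fin k → W) :
    Matrix (Fin l → W) (Fin k → W) ℂ :=
  fun m j => ∑ σ : H,
    if m = (σ : Equiv.Perm W) ∘ a ∧ j = (σ : Equiv.Perm W) ∘ b then 1 else 0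

theorem orbitMatrix_smul {k l : ℕ} (a m : Fin l → W) (b j : Fin k → W) (τ : H) :
    orbitMatrix H a b ((τ : Equiv.Perm W) ∘ m) ((τ : Equiv.Perm W) ∘ j) =
      orbitMatrix H a b m j := by
  unfold orbitMatrix
  refine Fintype.sum_equiv (Equiv.mulLeft τ⁻¹) _ _ fun σ => ?_
  have h : ∀ {k : ℕ} (a m : Fin k → W), (τ : Equiv.Perm W) ∘ m = (σ : Equiv.Perm W) ∘ a ↔
      m = ((τ⁻¹ * σ : H) : Equiv.Perm W) ∘ a := by
    intro k a m
    simp only [funext_iff, Function.comp_apply, Subgroup.coe_mul, Equiv.Perm.mul_apply,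
      Subgroup.coe_inv, Equiv.Perm.eq_inv_iff_eq]
  exact if_congr (and_congr (h a m) (h b j)) rfl rfl

theorem orbitMatrix_mem {act : H → Γ →* Γ} (h : PermutesInvolutions g H act) {k l : ℕ}
    (a : Fin l → W) (b : Fin k → W) (hab : wordProd g a = wordProd g b) :
    orbitMatrix H a b ∈ semidirectMor g H k l := by
  refine ⟨fun τ m j => orbitMatrix_smul H a m b j τ, fun m j hmj => ?_⟩
  obtain ⟨σ, -, hσ⟩ := Finset.exists_ne_zero_of_sum_ne_zero hmj
  obtain ⟨rfl, rfl⟩ : m = (σ : Equiv.Perm W) ∘ a ∧ j = (σ : Equiv.Perm W) ∘ b := by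
    by_contra hcon
    exact hσ (if_neg hcon)
  rw [← h.act_wordProd, ← h.act_wordProd, hab]

/-- Averaging the expansion of `T` in matrix units over `H` turns the units into orbit matrices. As
only non-vanishing entries contribute, `semidirectMor` is spanned by the orbit matrices of pairs of
words with equal value in `Γ`. -/
theorem card_smul_eq_sum_orbitMatrix [Fintype W] {k l : ℕ}
    {T : Matrix (Fin l → W) (Fin k → W) ℂ} (hT : T ∈ semidirectMor g H k l) :
    (Fintype.card H : ℂ) • T = ∑ m, ∑ j, T m j • orbitMatrix H m j := by
  ext m j
  simp only [Matrix.smul_apply, Matrix.sum_apply, orbitMatrix, smul_eq_mul]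
  simp_rw [Finset.mul_sum]
  have h1 : ∀ σ : H, ∑ a, ∑ b, T a b *
      (if m = (σ : Equiv.Perm W) ∘ a ∧ j = (σ : Equiv.Perm W) ∘ b then 1 else 0) = T m j := by
    intro σ
    have h2 : ∀ {k : ℕ} (a m : Fin k → W), m = (σ : Equiv.Perm W) ∘ a ↔
        a = ((σ⁻¹ : H) : Equiv.Perm W) ∘ m := by
      intro k a m
      simp only [funext_iff, Function.comp_apply, Subgroup.coe_inv, Equiv.Perm.eq_inv_iff_eq]
      exact forall_congr' fun r => eq_comm
    simp_rw [h2, ite_and, mul_ite, mul_zero, mul_one]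
    simp [← hT.1 σ⁻¹ m j]
  calc _ = ∑ σ : H, T m j := by simp
    _ = ∑ σ : H, ∑ a, ∑ b, T a b *
      (if m = (σ : Equiv.Perm W) ∘ a ∧ j = (σ : Equiv.Perm W) ∘ b then 1 else 0) := by
        simp_rw [h1]
    _ = _ := by
      rw [Finset.sum_comm]
      refine Finset.sum_congr rfl fun a _ => ?_
      rw [Finset.sum_comm]

end SemidirectMor

/-! ### The algebra of the semidirect product -/

section SemidirectAlgebra

variable {Γ : Type*} [Group Γ] {H : Type*} [DecidableEq H]

/-- The elements `γ ⊗ δ_σ`, which form a basis of `ℂΓ ⊗ O(H)`. -/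
def elementaryTensor (γ : Γ) (σ : H) : SemidirectAlgebra Γ H :=
  MonoidAlgebra.single γ 1 ⊗ₜ Pi.single σ 1

theorem elementaryTensor_mul (γ γ' : Γ) (σ τ : H) :
    elementaryTensor γ σ * elementaryTensor γ' τ =
      if σ = τ then elementaryTensor (γ * γ') σ else 0 := by
  unfold elementaryTensor
  rw [Algebra.TensorProduct.tmul_mul_tmul, MonoidAlgebra.single_mul_single, mul_one]
  split_ifs with h
  · subst h
    rw [← Pi.single_mul, mul_one]
  · have h0 : (Pi.single σ 1 * Pi.single τ 1 : H → ℂ) = 0 := by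
      ext ρ
      by_cases hρ : ρ = σ
      · subst hρ; simp [h]
      · simp [hρ]
    rw [h0, TensorProduct.tmul_zero]

theorem star_elementaryTensor (γ : Γ) (σ : H) :
    star (elementaryTensor γ σ) = elementaryTensor γ⁻¹ σ := by
  unfold elementaryTensor
  rw [TensorProduct.star_tmul, GroupStarAlgebra.star_single, star_one]
  congr 1
  ext τ
  by_cases h : τ = σ
  · subst h; simp
  · simp [h]

variable [Fintype H]

theorem tmul_eq_sum_elementaryTensor (γ : Γ) (f : H → ℂ) :
    (MonoidAlgebra.single γ 1 ⊗ₜ f : SemidirectAlgebra Γ H) =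
      ∑ σ, f σ • elementaryTensor γ σ := by
  conv_lhs => rw [← Finset.univ_sum_single f, TensorProduct.tmul_sum]
  refine Finset.sum_congr rfl fun σ _ => ?_
  rw [elementaryTensor, ← TensorProduct.tmul_smul, ← Pi.single_smul, smul_eq_mul, mul_one]

theorem sum_elementaryTensor_one :
    ∑ σ : H, elementaryTensor (1 : Γ) σ = 1 := by
  have h := tmul_eq_sum_elementaryTensor (1 : Γ) (1 : H → ℂ)
  simp only [Pi.one_apply, one_smul] at h
  rw [← h]
  rfl

theorem span_elementaryTensor :
    Submodule.span ℂ (Set.range fun p : Γ × H => elementaryTensor p.1 p.2) = ⊤ := by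
  rw [eq_top_iff]
  rintro x -
  induction x using TensorProduct.induction_on with
  | zero => exact zero_mem _
  | add x y hx hy => exact add_mem hx hy
  | tmul x f =>
    induction x using MonoidAlgebra.induction_linear with
    | zero => rw [TensorProduct.zero_tmul]; exact zero_mem _
    | add x y hx hy => rw [TensorProduct.add_tmul]; exact add_mem hx hy
    | single γ c =>
      have h : MonoidAlgebra.single γ c = c • (MonoidAlgebra.single γ 1 : MonoidAlgebra ℂ Γ) := by
        rw [MonoidAlgebra.smul_single, smul_eq_mul, mul_one]
      rw [h, ← TensorProduct.smul_tmul', tmul_eq_sum_elementaryTensor]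
      exact Submodule.smul_mem _ _ (Submodule.sum_mem _ fun σ _ =>
        Submodule.smul_mem _ _ (Submodule.subset_span ⟨(γ, σ), rfl⟩))

/-- The part of an element of `ℂΓ ⊗ O(H)` at an element of `H`. -/
def evalTensor (Γ : Type*) [Group Γ] {H : Type*} (σ : H) :
    SemidirectAlgebra Γ H →ₗ[ℂ] MonoidAlgebra ℂ Γ :=
  (TensorProduct.rid ℂ (MonoidAlgebra ℂ Γ)).toLinearMap ∘ₗ
    LinearMap.lTensor (MonoidAlgebra ℂ Γ) (LinearMap.proj σ)

theorem evalTensor_tmul {H : Type*} (σ : H) (x : MonoidAlgebra ℂ Γ) (f : H → ℂ) :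
    evalTensor Γ σ (x ⊗ₜ f) = f σ • x := by
  simp [evalTensor]

theorem eq_sum_evalTensor (x : SemidirectAlgebra Γ H) :
    x = ∑ σ, evalTensor Γ σ x ⊗ₜ[ℂ] (Pi.single σ 1 : H → ℂ) := by
  induction x using TensorProduct.induction_on with
  | zero => simp
  | add x y hx hy =>
    simp_rw [map_add, TensorProduct.add_tmul, Finset.sum_add_distrib]
    rw [← hx, ← hy]
  | tmul x f =>
    conv_lhs => rw [← Finset.univ_sum_single f, TensorProduct.tmul_sum]
    refine Finset.sum_congr rfl fun σ _ => ?_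
    rw [evalTensor_tmul, TensorProduct.smul_tmul, ← Pi.single_smul, smul_eq_mul, mul_one]

variable {C : Type*} [Ring C] [Algebra ℂ C] [StarRing C] [StarModule ℂ C]

/-- The universal property of the basis `γ ⊗ δ_σ`. Summing over `σ` gives a representation `ρ` of
`Γ`, and the idempotents `b 1 σ` give a representation `π` of the functions on `H`; the two commute
since both products of `ρ γ` and `b 1 σ` are `b γ σ`. -/
theorem exists_starAlgHom_elementaryTensor (b : Γ → H → C)
    (hmul : ∀ γ γ' σ τ, b γ σ * b γ' τ = if σ = τ then b (γ * γ') σ else 0)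
    (hone : ∑ σ, b 1 σ = 1) (hstar : ∀ γ σ, star (b γ σ) = b γ⁻¹ σ) :
    ∃ Φ : SemidirectAlgebra Γ H →⋆ₐ[ℂ] C, ∀ γ σ, Φ (elementaryTensor γ σ) = b γ σ := by
  let ρ : Γ →* C :=
    { toFun := fun γ => ∑ σ, b γ σ
      map_one' := hone
      map_mul' := fun γ γ' => by simp [Finset.sum_mul_sum, hmul] }
  let π : (H → ℂ) →ₐ[ℂ] C :=
    { toFun := fun f => ∑ σ, f σ • b 1 σ
      map_one' := by simpa using hone
      map_mul' := fun f f' => by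
        simp only [Pi.mul_apply, Finset.sum_mul_sum, smul_mul_smul_comm, hmul, mul_one, smul_ite,
          smul_zero, Finset.sum_ite_eq, Finset.mem_univ, if_true]
      map_zero' := by simp
      map_add' := fun f f' => by simp [add_smul, Finset.sum_add_distrib]
      commutes' := fun c => by
        rw [Algebra.algebraMap_eq_smul_one (A := C), ← hone, Finset.smul_sum]
        simp }
  have hρ : ∀ γ σ, ρ γ * b 1 σ = b γ σ := fun γ σ => by
    simp [ρ, Finset.sum_mul, hmul]
  have hρ' : ∀ γ σ, b 1 σ * ρ γ = b γ σ := fun γ σ => by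
    simp [ρ, Finset.mul_sum, hmul]
  let Φ : SemidirectAlgebra Γ H →ₐ[ℂ] C :=
    Algebra.TensorProduct.lift (MonoidAlgebra.lift ℂ C Γ ρ) π (by
      intro x f
      induction x using MonoidAlgebra.induction_linear with
      | zero => simp
      | add x y hx hy => rw [map_add]; exact hx.add_left hy
      | single γ c =>
        rw [MonoidAlgebra.lift_single]
        refine Commute.smul_left ?_ c
        change ρ γ * ∑ σ, f σ • b 1 σ = (∑ σ, f σ • b 1 σ) * ρ γ
        simp [Finset.mul_sum, Finset.sum_mul, hρ, hρ'])
  have hΦ : ∀ γ σ, Φ (elementaryTensor γ σ) = b γ σ := by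
    intro γ σ
    have h1 : π (Pi.single σ 1) = b 1 σ := by
      change ∑ τ, (Pi.single σ 1 : H → ℂ) τ • b 1 τ = b 1 σ
      simp [Pi.single_apply]
    change Algebra.TensorProduct.lift _ _ _ (_ ⊗ₜ _) = _
    rw [Algebra.TensorProduct.lift_tmul, MonoidAlgebra.lift_single, one_smul, h1, hρ]
  refine ⟨{ Φ with map_star' := fun x => ?_ }, hΦ⟩
  change Φ (star x) = star (Φ x)
  have hx : x ∈ Submodule.span ℂ (Set.range fun p : Γ × H => elementaryTensor p.1 p.2) :=
    span_elementaryTensor (Γ := Γ) (H := H) ▸ Submodule.mem_top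
  induction hx using Submodule.span_induction with
  | mem x hx =>
    obtain ⟨p, rfl⟩ := hx
    simp only [star_elementaryTensor, hΦ, hstar]
  | zero => simp
  | add x y _ _ hx hy => rw [star_add, map_add, hx, hy, map_add, star_add]
  | smul c x _ hx => rw [star_smul, map_smul, hx, map_smul, star_smul]

end SemidirectAlgebra

/-! ### The semidirect product as a compact matrix quantum group -/

section SemidirectRep

variable {W : Type*} {Γ : Type*} [Group Γ] {g : W → Γ} {H : Subgroup (Equiv.Perm W)}
  {act : H → Γ →* Γ}

theorem comp_eq_comp_iff (σ : H) {k : ℕ} (a m : Fin k → W) :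
    m = (σ : Equiv.Perm W) ∘ a ↔ a = ((σ⁻¹ : H) : Equiv.Perm W) ∘ m := by
  simp only [funext_iff, Function.comp_apply, Subgroup.coe_inv, Equiv.Perm.eq_inv_iff_eq]
  exact forall_congr' fun r => eq_comm

theorem apply_eq_iff (σ : H) (x y : W) :
    y = (σ : Equiv.Perm W) x ↔ x = ((σ⁻¹ : H) : Equiv.Perm W) y := by
  rw [Subgroup.coe_inv, Equiv.Perm.eq_inv_iff_eq, eq_comm]

variable [DecidableEq W]

/-- The two tensor factors commute, so the group elements and the indicator functions multiply
separately. The action of `H` on `Γ` enters only through the comultiplication. -/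
theorem tensorPow_semidirectRep_eq_tmul (g : W → Γ) (H : Subgroup (Equiv.Perm W)) {k : ℕ}
    (m j : Fin k → W) :
    tensorPow (semidirectRep g H) k m j =
      MonoidAlgebra.single (wordProd g m) 1 ⊗ₜ
        fun σ : H => if m = (σ : Equiv.Perm W) ∘ j then 1 else 0 := by
  induction k with
  | zero =>
    rw [tensorPow_zero, wordProd_zero]
    have h : (fun σ : H => if m = (σ : Equiv.Perm W) ∘ j then (1 : ℂ) else 0) = 1 := by
      ext σ
      simp [Subsingleton.elim m ((σ : Equiv.Perm W) ∘ j)]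
    rw [h]
    rfl
  | succ k ih =>
    rw [tensorPow_succ, ih, semidirectRep, Algebra.TensorProduct.tmul_mul_tmul,
      MonoidAlgebra.single_mul_single, mul_one, ← wordProd_cons, Fin.cons_self_tail]
    congr 1
    ext σ
    simp only [Pi.mul_apply, ite_zero_mul_ite_zero, mul_one]
    refine if_congr ?_ rfl rfl
    simp only [funext_iff, Function.comp_apply, Fin.forall_fin_succ (P := fun r => m r = _),
      Fin.tail]

variable [Fintype W]

theorem tensorPow_semidirectRep (g : W → Γ) (H : Subgroup (Equiv.Perm W)) [Fintype H] {k : ℕ}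
    (m j : Fin k → W) :
    tensorPow (semidirectRep g H) k m j = ∑ σ : H,
      if m = (σ : Equiv.Perm W) ∘ j then elementaryTensor (wordProd g m) σ else 0 := by
  rw [tensorPow_semidirectRep_eq_tmul, tmul_eq_sum_elementaryTensor]
  simp only [ite_smul, one_smul, zero_smul]

theorem semidirectRep_apply (g : W → Γ) (H : Subgroup (Equiv.Perm W)) [Fintype H] (x y : W) :
    semidirectRep g H x y = ∑ σ : H,
      if x = (σ : Equiv.Perm W) y then elementaryTensor (g x) σ else 0 := by
  rw [semidirectRep, tmul_eq_sum_elementaryTensor]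
  simp only [ite_smul, one_smul, zero_smul]

theorem evalTensor_elementaryTensor (γ : Γ) (σ τ : H) :
    evalTensor Γ σ (elementaryTensor γ τ) = if σ = τ then MonoidAlgebra.single γ 1 else 0 := by
  rw [elementaryTensor, evalTensor_tmul, Pi.single_apply]
  split_ifs <;> simp

namespace PermutesInvolutions

variable [Fintype H]

/-- The `σ`-component of the intertwiner equation reads `T m (σ ∘ j) • g_{σ ∘ j} = T (σ⁻¹ ∘ m) j •
g_m` in the group algebra. For `σ = 1` this is the support condition; given that condition, the
remaining `σ` express invariance. -/
theorem mor_semidirectRep (k l : ℕ) : Mor (semidirectRep g H) k l = semidirectMor g H k l := by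
  ext T
  have hL : ∀ m j, ∑ p, T m p • tensorPow (semidirectRep g H) k p j = ∑ σ : H,
      T m ((σ : Equiv.Perm W) ∘ j) •
        elementaryTensor (wordProd g ((σ : Equiv.Perm W) ∘ j)) σ := by
    intro m j
    simp_rw [tensorPow_semidirectRep, Finset.smul_sum]
    rw [Finset.sum_comm]
    simp
  have hR : ∀ m j, ∑ p, T p j • tensorPow (semidirectRep g H) l m p = ∑ σ : H,
      T (((σ⁻¹ : H) : Equiv.Perm W) ∘ m) j • elementaryTensor (wordProd g m) σ := by
    intro m j
    simp_rw [tensorPow_semidirectRep, Finset.smul_sum]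
    rw [Finset.sum_comm]
    refine Finset.sum_congr rfl fun σ _ => ?_
    simp_rw [comp_eq_comp_iff σ _ m]
    simp
  rw [mem_Mor_iff, mem_semidirectMor]
  simp_rw [hL, hR]
  constructor
  · intro hT
    have hT' : ∀ (σ : H) m j, T m ((σ : Equiv.Perm W) ∘ j) •
        (MonoidAlgebra.single (wordProd g ((σ : Equiv.Perm W) ∘ j)) 1 : MonoidAlgebra ℂ Γ) =
          T (((σ⁻¹ : H) : Equiv.Perm W) ∘ m) j • MonoidAlgebra.single (wordProd g m) 1 := by
      intro σ m j
      have h1 := congrArg (evalTensor Γ σ) (hT m j)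
      simpa only [map_sum, map_smul, evalTensor_elementaryTensor, smul_ite, smul_zero,
        Finset.sum_ite_eq, Finset.mem_univ, if_true] using h1
    have hsupp : ∀ m j, T m j ≠ 0 → wordProd g m = wordProd g j := by
      intro m j hmj
      have h1 : T m j • (MonoidAlgebra.single (wordProd g j) 1 : MonoidAlgebra ℂ Γ) =
          T m j • MonoidAlgebra.single (wordProd g m) 1 := by
        simpa using hT' 1 m j
      have h2 := smul_right_injective _ hmj h1
      exact (MonoidAlgebra.single_left_injective one_ne_zero h2).symm
    refine ⟨fun σ m j => ?_, hsupp⟩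
    have h1 := hT' σ ((σ : Equiv.Perm W) ∘ m) j
    have h2 : ((σ⁻¹ : H) : Equiv.Perm W) ∘ ((σ : Equiv.Perm W) ∘ m) = m :=
      ((comp_eq_comp_iff σ m _).1 rfl).symm
    rw [h2] at h1
    -- If this entry vanishes, then so does the other, because basis elements are nonzero; otherwise
    -- the support condition identifies the two group elements and they can be cancelled.
    by_cases h0 : T ((σ : Equiv.Perm W) ∘ m) ((σ : Equiv.Perm W) ∘ j) = 0
    · rw [h0, zero_smul] at h1
      rcases smul_eq_zero.1 h1.symm with h3 | h3
      · rw [h0, h3]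
      · exact absurd h3 (by simp)
    · rw [hsupp _ _ h0] at h1
      exact smul_left_injective ℂ (m := (MonoidAlgebra.single
        (wordProd g ((σ : Equiv.Perm W) ∘ j)) 1 : MonoidAlgebra ℂ Γ)) (by simp) h1
  · rintro ⟨hinv, hsupp⟩ m j
    refine Finset.sum_congr rfl fun σ _ => ?_
    have h2 : T m ((σ : Equiv.Perm W) ∘ j) = T (((σ⁻¹ : H) : Equiv.Perm W) ∘ m) j := by
      rw [← hinv σ (((σ⁻¹ : H) : Equiv.Perm W) ∘ m), ← (comp_eq_comp_iff σ _ m).2 rfl]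
    by_cases h0 : T m ((σ : Equiv.Perm W) ∘ j) = 0
    · rw [← h2, h0, zero_smul, zero_smul]
    · rw [hsupp _ _ h0, h2]

/-- Every basis element is thus a single entry of a tensor power. This shows that the entries of `u`
generate the algebra, and it prescribes the formula for `Φ` in `exists_starAlgHom`. -/
theorem _root_.tensorPow_semidirectRep_of_surjective {k : ℕ} {m : Fin k → W}
    (hm : Function.Surjective m) (σ : H) :
    tensorPow (semidirectRep g H) k m (((σ⁻¹ : H) : Equiv.Perm W) ∘ m) =
      elementaryTensor (wordProd g m) σ := by
  rw [tensorPow_semidirectRep, Finset.sum_eq_single σ]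
  · rw [if_pos ((comp_eq_comp_iff σ _ m).2 rfl)]
  · intro τ _ hτ
    rw [if_neg]
    rw [comp_eq_comp_iff]
    intro h1
    exact hτ (inv_injective (Subtype.ext (Equiv.coe_fn_injective
      (hm.injective_comp_right h1)))).symm
  · simp

theorem adjoin_semidirectRep (h : PermutesInvolutions g H act) :
    Algebra.adjoin ℂ {a | ∃ i j, a = semidirectRep g H i j} = ⊤ := by
  rw [← Algebra.toSubmodule_eq_top, eq_top_iff, ← span_elementaryTensor, Submodule.span_le]
  rintro _ ⟨⟨γ, σ⟩, rfl⟩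
  obtain ⟨k, m, hm, rfl⟩ := h.exists_surjective_wordProd_eq γ
  simp only [← tensorPow_semidirectRep_of_surjective hm]
  refine Subalgebra.list_prod_mem _ fun x hx => ?_
  obtain ⟨r, rfl⟩ := List.mem_ofFn.1 hx
  exact Algebra.subset_adjoin ⟨_, _, rfl⟩

/-- The twist by `act σ⁻¹` in the second leg is forced: in `u i k ⊗ u k j`, the component `σ` of the
first factor has `k = σ⁻¹ i`, so `g k` is the image of `g i` under `act σ⁻¹`. The formula on the
whole basis is needed again for injectivity. -/
theorem exists_comul (h : PermutesInvolutions g H act) : ∃ Δ : SemidirectAlgebra Γ H →⋆ₐ[ℂ]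
    SemidirectAlgebra Γ H ⊗[ℂ] SemidirectAlgebra Γ H,
    (∀ γ ρ, Δ (elementaryTensor γ ρ) =
      ∑ σ, elementaryTensor γ σ ⊗ₜ elementaryTensor (act σ⁻¹ γ) (σ⁻¹ * ρ)) ∧
    ∀ i j, Δ (semidirectRep g H i j) =
      ∑ k, semidirectRep g H i k ⊗ₜ[ℂ] semidirectRep g H k j := by
  obtain ⟨Δ, hΔ⟩ := exists_starAlgHom_elementaryTensor
    (C := SemidirectAlgebra Γ H ⊗[ℂ] SemidirectAlgebra Γ H)
    (fun (γ : Γ) (ρ : H) =>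
      ∑ σ, elementaryTensor γ σ ⊗ₜ elementaryTensor (act σ⁻¹ γ) (σ⁻¹ * ρ)) (by
      intro γ γ' ρ ρ'
      have h1 : ∀ σ σ' : H, (elementaryTensor γ σ ⊗ₜ elementaryTensor (act σ⁻¹ γ) (σ⁻¹ * ρ) :
          SemidirectAlgebra Γ H ⊗[ℂ] SemidirectAlgebra Γ H) *
          elementaryTensor γ' σ' ⊗ₜ elementaryTensor (act σ'⁻¹ γ') (σ'⁻¹ * ρ') =
          if σ = σ' then (if ρ = ρ' then elementaryTensor (γ * γ') σ ⊗ₜ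
            elementaryTensor (act σ⁻¹ (γ * γ')) (σ⁻¹ * ρ) else 0) else 0 := by
        intro σ σ'
        rw [Algebra.TensorProduct.tmul_mul_tmul, elementaryTensor_mul, elementaryTensor_mul]
        by_cases hσ : σ = σ'
        · subst hσ
          rw [if_pos rfl, if_pos rfl, ← map_mul, if_congr (mul_right_inj σ⁻¹) rfl rfl]
          split_ifs <;> simp
        · rw [if_neg hσ, if_neg hσ, TensorProduct.zero_tmul]
      refine (Finset.sum_mul_sum (R := SemidirectAlgebra Γ H ⊗[ℂ] SemidirectAlgebra Γ H)
        _ _ _ _).trans ?_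
      refine (Finset.sum_congr rfl fun σ _ => (Finset.sum_congr rfl fun τ _ => h1 σ τ)).trans ?_
      simp only [Finset.sum_ite_eq, Finset.mem_univ, if_true]
      split_ifs <;> simp) (by
      have h0 : ∀ σ : H, act σ 1 = 1 := fun σ => (act σ).map_one
      simp only [h0]
      rw [Finset.sum_comm]
      have h1 : ∀ σ : H, ∑ ρ, (elementaryTensor (1 : Γ) σ ⊗ₜ[ℂ] elementaryTensor (1 : Γ) (σ⁻¹ * ρ)
          : SemidirectAlgebra Γ H ⊗[ℂ] SemidirectAlgebra Γ H) =
          elementaryTensor (1 : Γ) σ ⊗ₜ 1 := by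
        intro σ
        rw [← TensorProduct.tmul_sum, ← sum_elementaryTensor_one]
        congr 1
        exact Fintype.sum_equiv (Equiv.mulLeft σ⁻¹) _ _ fun _ => rfl
      simp_rw [h1]
      rw [← TensorProduct.sum_tmul, sum_elementaryTensor_one]
      rfl) (by
      intro γ ρ
      rw [star_sum]
      refine Finset.sum_congr rfl fun σ _ => ?_
      rw [TensorProduct.star_tmul, star_elementaryTensor, star_elementaryTensor, map_inv])
  refine ⟨Δ, hΔ, fun i j => ?_⟩
  have hk : ∀ k, (semidirectRep g H i k ⊗ₜ[ℂ] semidirectRep g H k j :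
      SemidirectAlgebra Γ H ⊗[ℂ] SemidirectAlgebra Γ H) = ∑ σ : H, ∑ τ : H,
        if k = ((σ⁻¹ : H) : Equiv.Perm W) i then if k = (τ : Equiv.Perm W) j then
          elementaryTensor (g i) σ ⊗ₜ elementaryTensor (g k) τ else 0 else 0 := by
    intro k
    rw [semidirectRep_apply, semidirectRep_apply, TensorProduct.sum_tmul]
    refine Finset.sum_congr rfl fun σ _ => ?_
    rw [TensorProduct.tmul_sum]
    refine Finset.sum_congr rfl fun τ _ => ?_
    rw [if_congr (apply_eq_iff σ k i) rfl rfl]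
    split_ifs <;> simp
  simp_rw [hk]
  rw [Finset.sum_comm, semidirectRep_apply, map_sum]
  calc _ = ∑ ρ : H, ∑ σ : H, if i = (ρ : Equiv.Perm W) j then
        elementaryTensor (g i) σ ⊗ₜ[ℂ] elementaryTensor (g (((σ⁻¹ : H) : Equiv.Perm W) i))
          (σ⁻¹ * ρ) else (0 : SemidirectAlgebra Γ H ⊗[ℂ] SemidirectAlgebra Γ H) := by
        refine Finset.sum_congr rfl fun ρ _ => ?_
        split_ifs
        · rw [hΔ]
          simp_rw [h.act_gen]
        · simp
    _ = _ := by
        rw [Finset.sum_comm]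
        refine Finset.sum_congr rfl fun σ _ => ?_
        rw [Finset.sum_comm]
        refine Fintype.sum_equiv (Equiv.mulLeft σ⁻¹) _ _ fun ρ => ?_
        rw [Finset.sum_ite_eq' Finset.univ, if_pos (Finset.mem_univ _)]
        refine if_congr ?_ rfl rfl
        simp

theorem isOrthogonalCMQG_semidirectRep (h : PermutesInvolutions g H act) :
    IsOrthogonalCMQG (semidirectRep g H) where
  nontrivial := inferInstance
  generates := by
    rw [eq_top_iff, ← StarSubalgebra.toSubalgebra_le_iff, StarSubalgebra.top_toSubalgebra,
      ← h.adjoin_semidirectRep]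
    exact Algebra.adjoin_le (StarAlgebra.subset_adjoin ℂ _)
  isSelfAdjoint i j := by
    rw [IsSelfAdjoint, semidirectRep, TensorProduct.star_tmul, GroupStarAlgebra.star_single,
      star_one, inv_eq_of_mul_eq_one_left (h.mul_self i)]
    congr 1
    ext σ
    simp only [Pi.star_apply]
    split_ifs <;> simp
  mul_transpose := by
    ext i j
    simp only [Matrix.mul_apply, Matrix.transpose_apply, semidirectRep,
      Algebra.TensorProduct.tmul_mul_tmul, MonoidAlgebra.single_mul_single, mul_one]
    rw [← TensorProduct.tmul_sum]
    have h1 : ∑ k, ((fun σ : H => if i = (σ : Equiv.Perm W) k then (1 : ℂ) else 0) *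
        fun σ : H => if j = (σ : Equiv.Perm W) k then (1 : ℂ) else 0) =
        if i = j then 1 else 0 := by
      ext σ
      simp only [Finset.sum_apply, Pi.mul_apply, ite_zero_mul_ite_zero, mul_one, apply_eq_iff σ,
        ite_and, Finset.sum_ite_eq', Finset.mem_univ, if_true, EmbeddingLike.apply_eq_iff_eq]
      split_ifs <;> rfl
    rw [h1, Matrix.one_apply]
    split_ifs with hij
    · subst hij
      rw [h.mul_self]
      rfl
    · rw [TensorProduct.tmul_zero]
  transpose_mul := by
    ext i j
    simp only [Matrix.mul_apply, Matrix.transpose_apply, semidirectRep,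
      Algebra.TensorProduct.tmul_mul_tmul, MonoidAlgebra.single_mul_single, mul_one, h.mul_self]
    rw [← TensorProduct.tmul_sum]
    have h1 : ∑ k, ((fun σ : H => if k = (σ : Equiv.Perm W) i then (1 : ℂ) else 0) *
        fun σ : H => if k = (σ : Equiv.Perm W) j then (1 : ℂ) else 0) =
        if i = j then 1 else 0 := by
      ext σ
      simp only [Finset.sum_apply, Pi.mul_apply, ite_zero_mul_ite_zero, mul_one,
        ite_and, Finset.sum_ite_eq', Finset.mem_univ, if_true, EmbeddingLike.apply_eq_iff_eq]
      split_ifs <;> rfl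
    rw [h1, Matrix.one_apply]
    split_ifs with hij
    · rfl
    · rw [TensorProduct.tmul_zero]
  exists_comul := (exists_comul h).imp fun _ hΔ => hΔ.2

end PermutesInvolutions

end SemidirectRep

/-! ### Reconstruction of the semidirect product from its intertwiner spaces -/

section Surjective

variable {W : Type*} {H : Subgroup (Equiv.Perm W)}

theorem comp_eq_comp_iff_of_surjective {k : ℕ} {a : Fin k → W} (ha : Function.Surjective a)
    (σ τ : H) : (σ : Equiv.Perm W) ∘ a = (τ : Equiv.Perm W) ∘ a ↔ σ = τ :=
  ⟨fun h => Subtype.ext (Equiv.coe_fn_injective (ha.injective_comp_right h)),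
    fun h => by rw [h]⟩

theorem eq_comp_iff_of_surjective {k : ℕ} {a : Fin k → W} (ha : Function.Surjective a)
    (τ : H) : a = (τ : Equiv.Perm W) ∘ a ↔ 1 = τ := by
  rw [← comp_eq_comp_iff_of_surjective ha]
  rfl

theorem comp_append (σ : Equiv.Perm W) {k l : ℕ} (a : Fin k → W) (b : Fin l → W) :
    σ ∘ Fin.append a b = Fin.append (σ ∘ a) (σ ∘ b) := by
  ext r
  refine Fin.addCases (fun r => ?_) (fun r => ?_) r <;> simp

end Surjective

section Reconstruction

variable {W : Type*} [DecidableEq W] [Fintype W] {Γ : Type*} [Group Γ] {g : W → Γ}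
  {H : Subgroup (Equiv.Perm W)} [Fintype H] {act : H → Γ →* Γ}
  {B : Type*} [Ring B] [Algebra ℂ B] {v : Matrix W W B}

namespace PermutesInvolutions

/-- This is the intertwiner equation of `orbitMatrix H a b`, written out entrywise. The relations
for `v` in the next three lemmas are special cases. -/
theorem sum_tensorPow_eq (h : PermutesInvolutions g H act)
    (hM : ∀ k l, Mor v k l = semidirectMor g H k l) {k l : ℕ} {a : Fin l → W} {b : Fin k → W}
    (hab : wordProd g a = wordProd g b) (m : Fin l → W) (j : Fin k → W) :
    ∑ σ : H, (if m = (σ : Equiv.Perm W) ∘ a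
        then tensorPow v k ((σ : Equiv.Perm W) ∘ b) j else 0) =
      ∑ σ : H, if j = (σ : Equiv.Perm W) ∘ b
        then tensorPow v l m ((σ : Equiv.Perm W) ∘ a) else 0 := by
  have h1 : orbitMatrix H a b ∈ Mor v k l := hM k l ▸ orbitMatrix_mem g H h a b hab
  have h2 := (mem_Mor_iff v _).1 h1 m j
  simp only [orbitMatrix, Finset.sum_smul, ite_smul, one_smul, zero_smul, ite_and] at h2
  rw [Finset.sum_comm] at h2
  conv_rhs at h2 => rw [Finset.sum_comm]
  convert h2 using 2 with σ _ σ _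
  · split_ifs <;> simp
  · simp

/-- With both words equal to `j`, the left side vanishes when `m` is outside the orbit of `j`, while
the right side is the entry at `(m, j)` times the order of the stabiliser of `j`, which is not zero.
-/
theorem exists_eq_comp_of_tensorPow_ne_zero (h : PermutesInvolutions g H act)
    (hM : ∀ k l, Mor v k l = semidirectMor g H k l) {k : ℕ} {m j : Fin k → W}
    (hmj : tensorPow v k m j ≠ 0) : ∃ σ : H, m = (σ : Equiv.Perm W) ∘ j := by
  by_contra! hcon
  have h1 := h.sum_tensorPow_eq hM (rfl : wordProd g j = wordProd g j) m j
  rw [Finset.sum_eq_zero fun σ _ => if_neg (hcon σ)] at h1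
  have h2 : ∀ σ : H, (if j = (σ : Equiv.Perm W) ∘ j
      then tensorPow v k m ((σ : Equiv.Perm W) ∘ j) else 0) =
      (if j = (σ : Equiv.Perm W) ∘ j then (1 : ℂ) else 0) • tensorPow v k m j := by
    intro σ
    split_ifs with hσ
    · rw [← hσ, one_smul]
    · rw [zero_smul]
  simp_rw [h2] at h1
  rw [← Finset.sum_smul, Finset.sum_boole] at h1
  rcases smul_eq_zero.1 h1.symm with h3 | h3
  · rw [Nat.cast_eq_zero, Finset.card_eq_zero] at h3
    have h4 : (1 : H) ∈ Finset.univ.filter fun σ : H => j = (σ : Equiv.Perm W) ∘ j := by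
      simp
    rw [h3] at h4
    exact absurd h4 (Finset.notMem_empty _)
  · exact hmj h3

/-- Trivial stabilisers reduce each sum to one term. Consequently such an entry depends only on the
value of the word in `Γ` and on `σ`, so it can serve as the image of a basis element. -/
theorem tensorPow_eq_of_wordProd_eq (h : PermutesInvolutions g H act)
    (hM : ∀ k l, Mor v k l = semidirectMor g H k l) {k l : ℕ} {a : Fin l → W} {b : Fin k → W}
    (ha : Function.Surjective a) (hb : Function.Surjective b)
    (hab : wordProd g a = wordProd g b) (σ : H) :
    tensorPow v l a ((σ : Equiv.Perm W) ∘ a) = tensorPow v k b ((σ : Equiv.Perm W) ∘ b) := by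
  have h1 := h.sum_tensorPow_eq hM hab a ((σ : Equiv.Perm W) ∘ b)
  simp only [eq_comp_iff_of_surjective ha, comp_eq_comp_iff_of_surjective hb] at h1
  simpa using h1.symm

theorem sum_tensorPow_eq_one (h : PermutesInvolutions g H act)
    (hM : ∀ k l, Mor v k l = semidirectMor g H k l) {k : ℕ} {a : Fin k → W}
    (ha : Function.Surjective a) (h1 : wordProd g a = 1) :
    ∑ σ : H, tensorPow v k a ((σ : Equiv.Perm W) ∘ a) = 1 := by
  have h2 := h.sum_tensorPow_eq hM (b := Fin.elim0) (by rw [h1, wordProd_zero]) a Fin.elim0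
  simp only [eq_comp_iff_of_surjective ha, tensorPow_zero] at h2
  rw [Finset.sum_ite_eq, if_pos (Finset.mem_univ _)] at h2
  rw [h2]
  exact Finset.sum_congr rfl fun σ _ => (if_pos (Subsingleton.elim _ _)).symm

/-- Multiplication of basis elements corresponds to concatenation of words, the involution to
reversal, and the unit to a surjective word with value `1`. -/
theorem exists_starAlgHom [StarRing B] [StarModule ℂ B] (h : PermutesInvolutions g H act)
    (hM : ∀ k l, Mor v k l = semidirectMor g H k l) (hsa : ∀ i j, IsSelfAdjoint (v i j)) :
    ∃ Φ : SemidirectAlgebra Γ H →⋆ₐ[ℂ] B, ∀ i j, Φ (semidirectRep g H i j) = v i j := by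
  choose k a ha hga using h.exists_surjective_wordProd_eq
  have hsurj : ∀ {l : ℕ} (γ : Γ) (m : Fin l → W), Function.Surjective (Fin.append (a γ) m) := by
    intro l γ m x
    obtain ⟨r, rfl⟩ := ha γ x
    exact ⟨Fin.castAdd l r, by simp⟩
  obtain ⟨Φ, hΦ⟩ := exists_starAlgHom_elementaryTensor
    (fun (γ : Γ) (σ : H) => tensorPow v (k γ) (a γ) (((σ⁻¹ : H) : Equiv.Perm W) ∘ a γ))
    (by
      intro γ γ' σ τ
      rw [← tensorPow_append]
      split_ifs with hστ
      · subst hστ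
        rw [← comp_append]
        exact h.tensorPow_eq_of_wordProd_eq hM (hsurj _ _) (ha _)
          (by rw [wordProd_append, hga, hga, hga]) _
      -- A nonzero product would put the two concatenated words in one orbit, by some `ρ`;
      -- triviality of the stabilisers of both halves then gives `ρ = σ` and `ρ = τ`.
      · by_contra hne
        obtain ⟨ρ, hρ⟩ := h.exists_eq_comp_of_tensorPow_ne_zero hM hne
        rw [comp_append] at hρ
        have h1 : a γ = ((ρ * σ⁻¹ : H) : Equiv.Perm W) ∘ a γ := by
          ext r
          simpa using congrFun hρ (Fin.castAdd _ r)
        have h2 : a γ' = ((ρ * τ⁻¹ : H) : Equiv.Perm W) ∘ a γ' := by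
          ext r
          simpa using congrFun hρ (Fin.natAdd _ r)
        rw [eq_comp_iff_of_surjective (ha _), eq_comm, mul_inv_eq_one] at h1 h2
        exact hστ (h1.symm.trans h2))
    (by
      rw [← h.sum_tensorPow_eq_one hM (ha 1) (hga 1)]
      exact Fintype.sum_equiv (Equiv.inv H) _ _ fun σ => rfl)
    (by
      intro γ σ
      rw [tensorPow_rev v hsa]
      exact h.tensorPow_eq_of_wordProd_eq hM ((ha γ).comp Fin.rev_surjective) (ha _)
        (by rw [hga]; exact (wordProd_rev g h.mul_self (a γ)).trans (by rw [hga])) _)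
  refine ⟨Φ, fun x y => ?_⟩
  -- Multiplying `v x y` by the unit, expanded over a surjective word with value `1`, turns it into
  -- a sum of entries for the word with `x` prepended, which is surjective and has value `g x`.
  rw [semidirectRep_apply, map_sum, ← mul_one (v x y),
    ← h.sum_tensorPow_eq_one hM (ha 1) (hga 1), Finset.mul_sum]
  refine Fintype.sum_equiv (Equiv.inv H) _ _ fun σ => ?_
  rw [Equiv.inv_apply, ← tensorPow_cons]
  have hcons : Function.Surjective (Fin.cons x (a 1) : Fin (k 1 + 1) → W) := fun y => by
    obtain ⟨r, rfl⟩ := ha 1 y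
    exact ⟨r.succ, by simp⟩
  split_ifs with hσ
  · have h1 : (Fin.cons y (((σ⁻¹ : H) : Equiv.Perm W) ∘ a 1) : Fin (k 1 + 1) → W) =
        ((σ⁻¹ : H) : Equiv.Perm W) ∘ (Fin.cons x (a 1) : Fin (k 1 + 1) → W) := by
      ext r
      refine Fin.cases ?_ (fun r => ?_) r
      · simp [hσ]
      · simp
    rw [h1, hΦ]
    refine h.tensorPow_eq_of_wordProd_eq hM (ha _) hcons ?_ _
    rw [wordProd_cons, hga, hga, mul_one]
  · rw [map_zero]
    by_contra hne
    obtain ⟨ρ, hρ⟩ := h.exists_eq_comp_of_tensorPow_ne_zero hM (Ne.symm hne)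
    have h1 : a 1 = ((ρ * σ⁻¹ : H) : Equiv.Perm W) ∘ a 1 := by
      ext r
      simpa using congrFun hρ r.succ
    rw [eq_comp_iff_of_surjective (ha _), eq_comm, mul_inv_eq_one] at h1
    subst h1
    exact hσ (by simpa using congrFun hρ 0)

end PermutesInvolutions

end Reconstruction

/-! ### Injectivity of the reconstructed homomorphism -/

section Injectivity

variable {W : Type*} [DecidableEq W] [Fintype W] {Γ : Type*} [Group Γ] {g : W → Γ}
  {H : Subgroup (Equiv.Perm W)} [Fintype H] {act : H → Γ →* Γ}
  {B : Type*} [Ring B] [Algebra ℂ B] {v : Matrix W W B}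

section TensorField

variable {k M N : Type*} [Field k] [AddCommGroup M] [Module k M] [AddCommGroup N] [Module k N]

theorem exists_eq_smul_of_tmul_eq_tmul {x x' : M} {y y' : N} (hx : x ≠ 0)
    (h : x ⊗ₜ[k] y = x' ⊗ₜ y') : ∃ c : k, y = c • y' := by
  obtain ⟨f, hf⟩ : ∃ f : Module.Dual k M, f x ≠ 0 := by
    by_contra! hcon
    exact hx ((Module.forall_dual_apply_eq_zero_iff k x).1 hcon)
  have h1 := congrArg ((TensorProduct.lid k N).toLinearMap ∘ₗ LinearMap.rTensor N f) h
  simp only [LinearMap.comp_apply, LinearMap.rTensor_tmul, LinearEquiv.coe_coe,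
    TensorProduct.lid_tmul] at h1
  exact ⟨(f x)⁻¹ * f x', by rw [mul_smul, ← h1, inv_smul_smul₀ hf]⟩

theorem tmul_ne_zero_of_field {x : M} {y : N} (hx : x ≠ 0) (hy : y ≠ 0) : x ⊗ₜ[k] y ≠ 0 := by
  intro h
  rw [← TensorProduct.tmul_zero N x] at h
  obtain ⟨c, hc⟩ := exists_eq_smul_of_tmul_eq_tmul hx h
  exact hy (by rw [hc, smul_zero])

end TensorField

theorem mul_elementaryTensor_one {Γ : Type*} [Group Γ] {H : Type*} [DecidableEq H] [Fintype H]
    (x : SemidirectAlgebra Γ H) (σ : H) :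
    x * elementaryTensor 1 σ = evalTensor Γ σ x ⊗ₜ Pi.single σ 1 := by
  induction x using TensorProduct.induction_on with
  | zero => simp
  | add x y hx hy => rw [add_mul, hx, hy, map_add, TensorProduct.add_tmul]
  | tmul x f =>
    rw [elementaryTensor, Algebra.TensorProduct.tmul_mul_tmul, evalTensor_tmul,
      ← MonoidAlgebra.one_def, mul_one, TensorProduct.smul_tmul]
    congr 1
    ext τ
    by_cases hτ : τ = σ
    · subst hτ; simp
    · simp [hτ]

namespace PermutesInvolutions

/-- `Φ` intertwines the comultiplications, as this can be checked on the generators `u i j`. -/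
theorem comul_map_elementaryTensor (h : PermutesInvolutions g H act)
    (Φ : SemidirectAlgebra Γ H →ₐ[ℂ] B) (hΦ : ∀ i j, Φ (semidirectRep g H i j) = v i j)
    (D : B →ₐ[ℂ] B ⊗[ℂ] B) (hD : ∀ i j, D (v i j) = ∑ k, v i k ⊗ₜ[ℂ] v k j) (γ : Γ) (ρ : H) :
    D (Φ (elementaryTensor γ ρ)) = ∑ σ, Φ (elementaryTensor γ σ) ⊗ₜ
      Φ (elementaryTensor (act σ⁻¹ γ) (σ⁻¹ * ρ)) := by
  obtain ⟨Δ, hΔ, hΔ'⟩ := h.exists_comul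
  have h1 : D.comp Φ = (Algebra.TensorProduct.map Φ Φ).comp Δ.toAlgHom := by
    refine AlgHom.ext_of_adjoin_eq_top (adjoin_semidirectRep h) ?_
    rintro _ ⟨i, j, rfl⟩
    change D (Φ (semidirectRep g H i j)) =
      Algebra.TensorProduct.map Φ Φ (Δ (semidirectRep g H i j))
    rw [hΦ, hD, hΔ', map_sum]
    simp_rw [Algebra.TensorProduct.map_tmul, hΦ]
  have h2 := AlgHom.congr_fun h1 (elementaryTensor γ ρ)
  change D (Φ (elementaryTensor γ ρ)) =
    Algebra.TensorProduct.map Φ Φ (Δ (elementaryTensor γ ρ)) at h2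
  rw [h2, hΔ, map_sum]
  simp_rw [Algebra.TensorProduct.map_tmul]

theorem tensorPow_map {A : Type*} [Ring A] [Algebra ℂ A] {n : Type*} (Φ : A →ₐ[ℂ] B)
    (u : Matrix n n A) {k : ℕ} (i j : Fin k → n) :
    tensorPow (u.map Φ) k i j = Φ (tensorPow u k i j) := by
  rw [tensorPow, tensorPow, map_list_prod, List.map_ofFn]
  rfl

/-- What could fail is that some `b 1 σ` vanishes or that two group elements have the same image at
`σ = 1`. Both are excluded by one construction: an element `ν` with `b ν 1 = b 1 1` yields a fixed
vector of a tensor power of `v`, which must satisfy the support and invariance conditions of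
`semidirectMor`. Then the `b γ 1` are distinct group-like elements, hence independent, and
independence is transported to every `σ`. -/
theorem injective_of_mor_eq [Nontrivial B] (h : PermutesInvolutions g H act)
    (hM : ∀ k l, Mor v k l = semidirectMor g H k l)
    (Φ : SemidirectAlgebra Γ H →ₐ[ℂ] B) (hΦ : ∀ i j, Φ (semidirectRep g H i j) = v i j)
    (D : B →ₐ[ℂ] B ⊗[ℂ] B) (hD : ∀ i j, D (v i j) = ∑ k, v i k ⊗ₜ[ℂ] v k j) :
    Function.Injective Φ := by
  set b : Γ → H → B := fun γ σ => Φ (elementaryTensor γ σ) with hb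
  have hmul : ∀ γ γ' σ τ, b γ σ * b γ' τ = if σ = τ then b (γ * γ') σ else 0 := by
    intro γ γ' σ τ
    rw [hb]
    simp only
    rw [← map_mul, elementaryTensor_mul, apply_ite Φ, map_zero]
  have hone : ∑ σ, b 1 σ = 1 := by
    rw [hb]
    simp only
    rw [← map_sum, sum_elementaryTensor_one, map_one]
  -- the components of the comultiplication
  obtain ⟨Dc, hDc⟩ : ∃ Dc : H → H → B →ₗ[ℂ] B ⊗[ℂ] B, ∀ σ τ γ,
      Dc σ τ (b γ (σ * τ)) = b γ σ ⊗ₜ b (act σ⁻¹ γ) τ := by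
    -- Multiplication by the idempotent `b 1 σ ⊗ b 1 τ` selects one summand of the comultiplication.
    refine ⟨fun σ τ => (LinearMap.mulRight ℂ (b 1 σ ⊗ₜ b 1 τ)) ∘ₗ D.toLinearMap,
      fun σ τ γ => ?_⟩
    simp only [LinearMap.comp_apply, AlgHom.toLinearMap_apply, LinearMap.mulRight_apply]
    rw [hb, h.comul_map_elementaryTensor Φ hΦ D hD]
    change (∑ ρ, b γ ρ ⊗ₜ[ℂ] b (act ρ⁻¹ γ) (ρ⁻¹ * (σ * τ))) * _ = _
    rw [Finset.sum_mul, Finset.sum_eq_single σ]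
    · rw [Algebra.TensorProduct.tmul_mul_tmul, hmul, hmul, if_pos rfl, if_pos (by group)]
      simp [hb]
    · intro ρ _ hρ
      rw [Algebra.TensorProduct.tmul_mul_tmul, hmul, if_neg hρ, TensorProduct.zero_tmul]
    · simp
  have hinv : ∀ γ σ, b 1 σ ≠ 0 → b γ σ ≠ 0 := by
    intro γ σ hσ h0
    apply hσ
    have h1 := hmul γ⁻¹ γ σ σ
    rw [if_pos rfl, inv_mul_cancel, h0, mul_zero] at h1
    exact h1.symm
  have hSmul : ∀ σ τ, b 1 σ ≠ 0 → b 1 τ ≠ 0 → b 1 (σ * τ) ≠ 0 := by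
    intro σ τ hσ hτ h0
    have h1 := hDc σ τ 1
    rw [h0, map_zero, map_one] at h1
    exact tmul_ne_zero_of_field hσ hτ h1.symm
  have hzero : ∀ γ σ, b 1 σ = 0 → b γ σ = 0 := by
    intro γ σ hσ
    by_contra hne
    have h1 := hmul γ 1 σ σ
    rw [if_pos rfl, mul_one, hσ, mul_zero] at h1
    exact hne h1.symm
  obtain ⟨σ₀, hσ₀⟩ : ∃ σ, b 1 σ ≠ 0 := by
    by_contra! hcon
    rw [Finset.sum_eq_zero fun σ _ => hcon σ] at hone
    exact zero_ne_one hone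
  -- The `σ` with `b 1 σ ≠ 0` are closed under products, hence form a subgroup because `H` is
  -- finite. Only positive powers are available at first.
  have hSpow : ∀ σ, b 1 σ ≠ 0 → ∀ n : ℕ, b 1 (σ ^ (n + 1)) ≠ 0 := by
    intro σ hσ n
    induction n with
    | zero => simpa using hσ
    | succ n ih => rw [pow_succ]; exact hSmul _ _ ih hσ
  have hS1 : b 1 1 ≠ 0 := by
    have h1 := hSpow σ₀ hσ₀ (orderOf σ₀ - 1)
    rwa [Nat.sub_add_cancel (orderOf_pos σ₀), pow_orderOf_eq_one] at h1
  have hSinv : ∀ σ, b 1 σ ≠ 0 → b 1 σ⁻¹ ≠ 0 := by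
    intro σ hσ
    -- The inverse is taken as the power `2 * orderOf σ - 1`, whose exponent stays positive even
    -- when `σ = 1`.
    have h1 := hSpow σ hσ (2 * orderOf σ - 2)
    have h2 : σ ^ (2 * orderOf σ - 2 + 1) = σ⁻¹ := by
      rw [eq_inv_iff_mul_eq_one, ← pow_succ]
      have h3 := orderOf_pos σ
      rw [show 2 * orderOf σ - 2 + 1 + 1 = orderOf σ * 2 by omega, pow_mul, pow_orderOf_eq_one,
        one_pow]
    rwa [h2] at h1
  -- an element of `Γ` which is trivial at the identity of `H` is trivial, and every `b 1 σ ≠ 0`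
  have key : ∀ ν, b ν 1 = b 1 1 → ν = 1 ∧ ∀ σ, b 1 σ ≠ 0 := by
    intro ν hν
    -- Applying `Dc τ⁻¹ τ` to `b ν 1 = b 1 1` equates two pure tensors, so their second legs are
    -- proportional. Where `b 1 τ = 0` the scalar is chosen to be `0`, which later shows that this
    -- case cannot occur.
    have hex : ∀ τ, ∃ c : ℂ, b (act τ ν) τ = c • b 1 τ ∧ (b 1 τ = 0 → c = 0) := by
      intro τ
      by_cases hτ : b 1 τ = 0
      · exact ⟨0, by rw [hzero _ _ hτ, zero_smul], fun _ => rfl⟩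
      have h1 := hDc τ⁻¹ τ ν
      have h2 := hDc τ⁻¹ τ 1
      rw [inv_mul_cancel, inv_inv] at h1 h2
      rw [hν, h2, map_one] at h1
      obtain ⟨c, hc⟩ := exists_eq_smul_of_tmul_eq_tmul (hinv _ _ (hSinv τ hτ)) h1.symm
      exact ⟨c, hc, fun h0 => absurd h0 hτ⟩
    choose c hc hc0 using hex
    -- Applying `Dc σ (σ⁻¹ * τ)` to the defining relation of `c τ` gives this compatibility, which
    -- is precisely what makes `f` below a fixed vector.
    have hcoc : ∀ σ τ, c (σ⁻¹ * τ) • b (act τ ν) σ = c τ • b 1 σ := by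
      intro σ τ
      by_cases hσ : b 1 σ = 0
      · rw [hzero _ _ hσ, hσ, smul_zero, smul_zero]
      by_cases hρ : b 1 (σ⁻¹ * τ) = 0
      · have hτ : b 1 τ = 0 := by
          by_contra hτ
          exact hSmul _ _ (hSinv σ hσ) hτ hρ
        rw [hc0 _ hρ, hc0 _ hτ, zero_smul, zero_smul]
      have h1 := hDc σ (σ⁻¹ * τ) (act τ ν)
      have h2 := hDc σ (σ⁻¹ * τ) 1
      rw [← h.act_mul, hc (σ⁻¹ * τ), mul_inv_cancel_left, hc τ, map_smul] at h1
      rw [mul_inv_cancel_left, map_one] at h2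
      rw [h2, TensorProduct.tmul_smul, TensorProduct.smul_tmul', TensorProduct.smul_tmul',
        ← sub_eq_zero, ← TensorProduct.sub_tmul] at h1
      by_contra hne
      exact tmul_ne_zero_of_field (sub_ne_zero.2 (Ne.symm hne)) hρ h1
    obtain ⟨k, a, ha, hga⟩ := h.exists_surjective_wordProd_eq ν
    -- The vector `∑ c τ e_{τ ∘ a}` on the orbit of a surjective word `a` with value `ν`.
    let f : Matrix (Fin k → W) (Fin 0 → W) ℂ := fun m _ =>
      ∑ τ : H, if m = (τ : Equiv.Perm W) ∘ a then c τ else 0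
    have hf : f ∈ semidirectMor g H 0 k := by
      rw [← hM, mem_Mor_iff]
      intro m j
      have hv : v = (semidirectRep g H).map Φ := by
        ext x y
        exact (hΦ x y).symm
      have hR : ∑ p, f p j • tensorPow v k m p = ∑ σ : H,
          f (((σ⁻¹ : H) : Equiv.Perm W) ∘ m) j • b (wordProd g m) σ := by
        simp_rw [hv, tensorPow_map, tensorPow_semidirectRep, map_sum, Finset.smul_sum]
        rw [Finset.sum_comm]
        refine Finset.sum_congr rfl fun σ _ => ?_
        simp_rw [comp_eq_comp_iff σ _ m, apply_ite Φ, map_zero]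
        simp [hb]
      have hL : ∑ p, f m p • tensorPow v 0 p j = f m j • 1 := by
        simp_rw [tensorPow_zero]
        simp [f]
      rw [hL, hR, ← hone]
      have h1 : ∀ σ, f (((σ⁻¹ : H) : Equiv.Perm W) ∘ m) j • b (wordProd g m) σ =
          ∑ τ : H, if m = (τ : Equiv.Perm W) ∘ a then c τ • b 1 σ else 0 := by
        intro σ
        simp only [f, Finset.sum_smul]
        refine Fintype.sum_equiv (Equiv.mulLeft σ) _ _ fun τ => ?_
        rw [Equiv.coe_mulLeft, ite_smul, zero_smul]
        refine (if_congr (?_ : _ ↔ m = ((σ * τ : H) : Equiv.Perm W) ∘ a) rfl rfl).trans ?_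
        · rw [eq_comm, ← comp_eq_comp_iff σ]
          rfl
        · split_ifs with hm
          · have hw : wordProd g m = act (σ * τ) ν := by rw [hm, ← h.act_wordProd, hga]
            rw [hw, ← hcoc σ (σ * τ), inv_mul_cancel_left]
          · rfl
      simp_rw [h1]
      rw [Finset.smul_sum]
      refine Finset.sum_congr rfl fun σ _ => ?_
      simp only [f, Finset.sum_smul, ite_smul, zero_smul]
    have hfa : ∀ σ : H, f ((σ : Equiv.Perm W) ∘ a) Fin.elim0 = c σ := by
      intro σ
      simp only [f, comp_eq_comp_iff_of_surjective ha]
      simp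
    have hf1 : f a Fin.elim0 = 1 := by
      have h1 : c 1 = 1 := by
        have h2 := hc 1
        rw [h.act_one, hν] at h2
        have h3 : (1 : ℂ) • b 1 1 = c 1 • b 1 1 := by rw [one_smul, ← h2]
        exact (smul_left_injective ℂ hS1 h3).symm
      rw [← h1, ← hfa 1]
      rfl
    -- As `f a = c 1 = 1`, the support condition gives `ν = 1`, and invariance gives `c σ = 1` for
    -- all `σ`, contradicting `c σ = 0` where `b 1 σ = 0`.
    refine ⟨?_, fun σ hσ => ?_⟩
    · rw [← hga, hf.2 a Fin.elim0 (by rw [hf1]; exact one_ne_zero), wordProd_zero]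
    · have h1 := hf.1 σ a Fin.elim0
      rw [Subsingleton.elim ((σ : Equiv.Perm W) ∘ Fin.elim0) Fin.elim0, hfa, hf1, hc0 σ hσ] at h1
      exact zero_ne_one h1
  have hinj : Function.Injective fun γ => b γ 1 := by
    intro γ γ' hγ
    have h1 : b (γ⁻¹ * γ') 1 = b 1 1 := by
      have h2 := hmul γ⁻¹ γ 1 1
      have h3 := hmul γ⁻¹ γ' 1 1
      rw [if_pos rfl] at h2 h3
      rw [← h3, ← show b γ 1 = b γ' 1 from hγ, h2, inv_mul_cancel]
    exact inv_mul_eq_one.1 (key _ h1).1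
  have hS := (key 1 rfl).2
  have hli : LinearIndependent ℂ fun γ => b γ 1 := by
    refine linearIndependent_of_map_eq_tmul_self (Dc 1 1) hinj (fun γ => hinv γ 1 hS1) fun γ => ?_
    have h1 := hDc 1 1 γ
    rwa [mul_one, inv_one, h.act_one] at h1
  rw [injective_iff_map_eq_zero]
  intro x hx
  rw [eq_sum_evalTensor x]
  refine Finset.sum_eq_zero fun σ _ => ?_
  have h1 : Φ (evalTensor Γ σ x ⊗ₜ Pi.single σ 1) = 0 := by
    rw [← mul_elementaryTensor_one, map_mul, hx, zero_mul]
  set y := evalTensor Γ σ x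
  have hy : y = ∑ γ ∈ y.coeff.support, y.coeff γ • MonoidAlgebra.single γ 1 := by
    conv_lhs => rw [← MonoidAlgebra.sum_coeff_single y]
    refine Finset.sum_congr rfl fun γ _ => ?_
    rw [MonoidAlgebra.smul_single, smul_eq_mul, mul_one]
  have h2 : ∑ γ ∈ y.coeff.support, y.coeff γ • b γ σ = 0 := by
    rw [hy, TensorProduct.sum_tmul, map_sum] at h1
    rw [← h1]
    refine Finset.sum_congr rfl fun γ _ => ?_
    rw [← TensorProduct.smul_tmul', map_smul]
    rfl
  -- `Dc 1 σ` sends `b γ σ` to `b γ 1 ⊗ b γ σ`; independence of the first legs kills each summand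
  -- separately.
  have h3 := congrArg (Dc 1 σ) h2
  rw [map_sum, map_zero] at h3
  have h4 : ∑ γ ∈ y.coeff.support, b γ 1 ⊗ₜ[ℂ] (y.coeff γ • b γ σ) = 0 := by
    rw [← h3]
    refine Finset.sum_congr rfl fun γ _ => ?_
    have h5 := hDc 1 σ γ
    rw [one_mul, inv_one, h.act_one] at h5
    rw [map_smul, h5, TensorProduct.tmul_smul]
  have h5 := (hli.linearIndepOn (s := (y.coeff.support : Set Γ))).eq_zero_of_sum_tmul_eq_zero _ h4
  rw [hy, Finset.sum_eq_zero, TensorProduct.zero_tmul]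
  intro γ hγ
  rcases smul_eq_zero.1 (h5 γ hγ) with h6 | h6
  · rw [h6, zero_smul]
  · exact absurd h6 (hinv γ σ (hS σ))

end PermutesInvolutions

end Injectivity

/-! ### The isomorphism with the semidirect product -/

section Reconstruction

variable {W : Type*} [DecidableEq W] [Fintype W] {Γ : Type*} [Group Γ] {g : W → Γ}
  {H : Subgroup (Equiv.Perm W)} [Fintype H] {act : H → Γ →* Γ}
  {B : Type*} [Ring B] [Algebra ℂ B] [StarRing B] [StarModule ℂ B] {v : Matrix W W B}

theorem PermutesInvolutions.exists_starAlgEquiv (h : PermutesInvolutions g H act)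
    (hM : ∀ k l, Mor v k l = semidirectMor g H k l) (hv : IsOrthogonalCMQG v) :
    ∃ Φ : SemidirectAlgebra Γ H ≃⋆ₐ[ℂ] B, ∀ i j, Φ (semidirectRep g H i j) = v i j := by
  obtain ⟨Φ, hΦ⟩ := h.exists_starAlgHom hM hv.isSelfAdjoint
  obtain ⟨D, hD⟩ := hv.exists_comul
  have := hv.nontrivial
  have hinj : Function.Injective Φ :=
    h.injective_of_mor_eq hM Φ.toAlgHom hΦ D.toAlgHom hD
  have hsurj : Function.Surjective Φ := by
    have h1 : StarAlgebra.adjoin ℂ {a : B | ∃ i j, a = v i j} ≤ Φ.range := by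
      refine StarAlgebra.adjoin_le ?_
      rintro _ ⟨i, j, rfl⟩
      exact ⟨_, hΦ i j⟩
    rw [hv.generates] at h1
    intro x
    exact h1 (StarSubalgebra.mem_top : x ∈ (⊤ : StarSubalgebra ℂ B))
  exact ⟨StarAlgEquiv.ofBijective Φ ⟨hinj, hsurj⟩, hΦ⟩

end Reconstruction

/-! ### Renaming the index set -/

section Reindex

variable {n n' : Type*} {A : Type*} [Ring A]

theorem tensorPow_reindex (e : n ≃ n') (u : Matrix n n A) {k : ℕ} (i j : Fin k → n') :
    tensorPow (Matrix.reindex e e u) k i j = tensorPow u k (e.symm ∘ i) (e.symm ∘ j) := rfl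

variable [Algebra ℂ A]

theorem mem_Mor_reindex [Fintype n] [Fintype n'] (e : n ≃ n') (u : Matrix n n A) {k l : ℕ}
    (T : Matrix (Fin l → n') (Fin k → n') ℂ) :
    T ∈ Mor (Matrix.reindex e e u) k l ↔ T.submatrix (e ∘ ·) (e ∘ ·) ∈ Mor u k l := by
  have hs : ∀ {k : ℕ} (i : Fin k → n), e.symm ∘ e ∘ i = i := fun i => by ext; simp
  rw [mem_Mor_iff, mem_Mor_iff]
  have hsum : ∀ {k : ℕ} (f : (Fin k → n') → A), ∑ p, f p = ∑ p : Fin k → n, f (e ∘ p) :=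
    fun f => (Fintype.sum_equiv (Equiv.arrowCongr (Equiv.refl _) e) _ _ fun p => rfl).symm
  simp only [hsum, tensorPow_reindex, hs, Matrix.submatrix_apply]
  constructor
  · intro hT m j
    simpa only [hs] using hT (e ∘ m) (e ∘ j)
  · intro hT m j
    have h1 := hT (e.symm ∘ m) (e.symm ∘ j)
    have hs' : ∀ {k : ℕ} (i : Fin k → n'), e ∘ e.symm ∘ i = i := fun i => by ext; simp
    simpa only [hs'] using h1

theorem IsOrthogonalCMQG.reindex [Fintype n] [DecidableEq n] [Fintype n'] [DecidableEq n']
    [StarRing A] [StarModule ℂ A] {u : Matrix n n A} (hu : IsOrthogonalCMQG u) (e : n ≃ n') :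
    IsOrthogonalCMQG (Matrix.reindex e e u) where
  nontrivial := hu.nontrivial
  generates := by
    rw [← hu.generates]
    congr 1
    ext a
    constructor
    · rintro ⟨i, j, rfl⟩
      exact ⟨_, _, rfl⟩
    · rintro ⟨i, j, rfl⟩
      exact ⟨e i, e j, by simp⟩
  isSelfAdjoint i j := hu.isSelfAdjoint _ _
  mul_transpose := by
    rw [Matrix.transpose_reindex, Matrix.reindex_apply, Matrix.reindex_apply,
      Matrix.submatrix_mul_equiv, hu.mul_transpose, Matrix.submatrix_one_equiv]
  transpose_mul := by
    rw [Matrix.transpose_reindex, Matrix.reindex_apply, Matrix.reindex_apply,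
      Matrix.submatrix_mul_equiv, hu.transpose_mul, Matrix.submatrix_one_equiv]
  exists_comul := by
    obtain ⟨Δ, hΔ⟩ := hu.exists_comul
    refine ⟨Δ, fun i j => ?_⟩
    simp only [Matrix.reindex_apply, Matrix.submatrix_apply, hΔ]
    exact Fintype.sum_equiv e _ _ fun k => by simp

end Reindex

/-! ### Free products of copies of `ℤ/2` -/

namespace FreeProdZ2

variable {U V W : Type*}

theorem map_gen (φ : V → W) (x : V) : map φ (gen x) = gen (φ x) := by
  simp [map, gen]

theorem gen_mul_self (x : V) : gen x * gen x = 1 := by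
  rw [gen, ← map_mul, ← ofAdd_add]
  have h : (1 + 1 : ZMod 2) = 0 := by decide
  rw [h, ofAdd_zero, map_one]

theorem closure_range_gen : Subgroup.closure (Set.range (gen : V → FreeProdZ2 V)) = ⊤ := by
  rw [eq_top_iff]
  rintro x -
  induction x using Monoid.CoprodI.induction_on with
  | one => exact one_mem _
  | of i m =>
    have hm : ∀ z : ZMod 2, z = 0 ∨ z = 1 := by decide
    rcases hm m.toAdd with h | h
    · have h1 : m = 1 := h
      rw [h1, map_one]
      exact one_mem _
    · have h1 : m = Multiplicative.ofAdd 1 := h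
      rw [h1]
      exact Subgroup.subset_closure ⟨i, rfl⟩
  | mul x y hx hy => exact mul_mem hx hy

theorem hom_ext {N : Type*} [Monoid N] {f f' : FreeProdZ2 V →* N}
    (h : ∀ x, f (gen x) = f' (gen x)) : f = f' := by
  refine MonoidHom.eq_of_eqOn_dense closure_range_gen ?_
  rintro _ ⟨x, rfl⟩
  exact h x

theorem map_map (φ : U → V) (ψ : V → W) (a : FreeProdZ2 U) :
    map ψ (map φ a) = map (ψ ∘ φ) a := by
  have h : (map ψ).comp (map φ) = map (ψ ∘ φ) := hom_ext fun x => by simp [map_gen]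
  exact DFunLike.congr_fun h a

theorem map_id (a : FreeProdZ2 V) : map id a = a := by
  have h : map id = MonoidHom.id (FreeProdZ2 V) := hom_ext fun x => by simp [map_gen]
  exact DFunLike.congr_fun h a

theorem map_word (φ : V → W) {k : ℕ} (a : Fin k → V) : map φ (word a) = word (φ ∘ a) := by
  change map φ (wordProd gen a) = wordProd gen (φ ∘ a)
  rw [map_wordProd]
  simp only [wordProd, Function.comp_apply, map_gen]

end FreeProdZ2

/-! ### Graph fibrations -/

/-- The union of a graph and the image of another graph. -/
def LGraph.supImage {U V : Type*} (L : LGraph V) (H : LGraph U) (φ : U → V) : LGraph V where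
  Adj x y := L.Adj x y ∨ ∃ a b, H.Adj a b ∧ x = φ a ∧ y = φ b
  symm x y h := by
    rcases h with h | ⟨a, b, h, hx, hy⟩
    · exact Or.inl (L.symm _ _ h)
    · exact Or.inr ⟨b, a, H.symm _ _ h, hy, hx⟩

namespace GraphFibration

variable {F : GraphFibration.{u}}

theorem Contains.one_mem {V : Type u} [Finite V] {K : LGraph V} (hK : F.Contains K) :
    1 ∈ F.fibre K := by
  rw [← F.coe_fibreSubgroup K hK]
  exact (F.fibreSubgroup K).one_mem

theorem Contains.mem_fibreSubgroup_iff {V : Type u} [Finite V] {K : LGraph V}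
    (hK : F.Contains K) {a : FreeProdZ2 V} : a ∈ F.fibreSubgroup K ↔ a ∈ F.fibre K := by
  rw [← F.coe_fibreSubgroup K hK, SetLike.mem_coe]

/-- The overlap identifies each vertex `x` of `H` with `φ x`. All vertices of `H` are then absorbed,
so the union has vertex set `V`. -/
theorem mul_map_mem_fibre_supImage {U V : Type u} [Finite U] [Finite V] {L : LGraph V}
    {H : LGraph U} {φ : U → V} (hφ : Function.Injective φ) {a : FreeProdZ2 V}
    (ha : a ∈ F.fibre L) {b : FreeProdZ2 U} (hb : b ∈ F.fibre H) :
    a * FreeProdZ2.map φ b ∈ F.fibre (L.supImage H φ) := by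
  let f : VertexOverlap V U :=
    { rel := fun v x => v = φ x
      right_unique := fun v x x' h h' => hφ (h.symm.trans h')
      left_unique := fun v v' x h h' => h.trans h'.symm }
  have hr : ∀ x, f.inr x = f.inl (φ x) := fun x => (Quot.sound ⟨φ x, x, rfl, rfl, rfl⟩).symm
  let e : f.UnionVertex ≃ V :=
    { toFun := Quot.lift (Sum.elim id φ) (by
        rintro _ _ ⟨v, x, hvx, rfl, rfl⟩
        exact hvx)
      invFun := f.inl
      left_inv := by
        rintro ⟨v | x⟩
        · rfl
        · exact (hr x).symm
      right_inv := fun v => rfl }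
  have hel : ∀ v, e (f.inl v) = v := fun v => rfl
  have her : ∀ x, e (f.inr x) = φ x := fun x => rfl
  have h1 := F.iso_mem (f.union L H) (L.supImage H φ) e (by
    intro p q
    obtain ⟨x, rfl⟩ := e.symm.surjective p
    obtain ⟨y, rfl⟩ := e.symm.surjective q
    rw [e.apply_symm_apply, e.apply_symm_apply]
    simp only [VertexOverlap.union, LGraph.supImage, hr]
    simp only [Equiv.symm_apply_eq, hel]
    constructor
    · rintro (⟨v, v', h, rfl, rfl⟩ | h)
      · exact Or.inl h
      · exact Or.inr h
    · rintro (h | h)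
      · exact Or.inl ⟨_, _, h, rfl, rfl⟩
      · exact Or.inr h) _ (F.union_mem L H f a ha b hb)
  rw [map_mul, FreeProdZ2.map_map, FreeProdZ2.map_map] at h1
  have h2 : e ∘ f.inl = id := funext hel
  have h3 : e ∘ f.inr = φ := funext her
  rwa [h2, h3, FreeProdZ2.map_id] at h1

theorem Contains.supImage {U V : Type u} [Finite U] [Finite V] {L : LGraph V} (hL : F.Contains L)
    {H : LGraph U} (hH : F.Contains H) {φ : U → V} (hφ : Function.Injective φ) :
    F.Contains (L.supImage H φ) :=
  ⟨_, mul_map_mem_fibre_supImage hφ hL.one_mem hH.one_mem⟩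

/-- Gluing `H` to `K` along an embedding adds no edges, so the union axiom says that fibres are
functorial for embeddings. -/
theorem map_mem_fibre {U V : Type u} [Finite U] [Finite V] {K : LGraph V} (hK : F.Contains K)
    {H : LGraph U} {φ : U → V} (hφ : H.IsEmbedding K φ) {b : FreeProdZ2 U}
    (hb : b ∈ F.fibre H) : FreeProdZ2.map φ b ∈ F.fibre K := by
  have h1 := mul_map_mem_fibre_supImage hφ.injective hK.one_mem hb
  rw [one_mul] at h1
  have h2 : K.supImage H φ = K := by
    ext x y
    constructor
    · rintro (h | ⟨a, b, h, rfl, rfl⟩)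
      · exact h
      · exact hφ.map_adj _ _ h
    · exact Or.inl
  rwa [h2] at h1

/-- Vertices are added one at a time, by unions with the one-vertex graph along the empty overlap.
-/
theorem contains_edgeless (F : GraphFibration.{u}) (V : Type u) [Finite V] :
    F.Contains (LGraph.edgeless V) := by
  refine Finite.induction_empty_option
    (P := fun α => ∀ _ : Finite α, F.Contains (LGraph.edgeless α)) ?_ ?_ ?_ V inferInstance
  · intro α β e h _
    have : Finite α := Finite.of_equiv _ e.symm
    exact ⟨_, F.iso_mem (LGraph.edgeless α) (LGraph.edgeless β) e (fun _ _ => Iff.rfl) _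
      (h this).one_mem⟩
  · exact fun _ => ⟨1, F.null_mem⟩
  · intro α _ h _
    let f : VertexOverlap α PUnit.{u + 1} :=
      { rel := fun _ _ => False
        right_unique := fun _ _ _ h _ => h.elim
        left_unique := fun _ _ _ h _ => h.elim }
    let e : f.UnionVertex ≃ Option α :=
      { toFun := Quot.lift (Sum.elim some fun _ => none) (by
          rintro _ _ ⟨_, _, h, _⟩
          exact h.elim)
        invFun := fun o => o.elim (f.inr PUnit.unit) f.inl
        left_inv := by rintro ⟨v | x⟩ <;> rfl
        right_inv := by rintro (_ | v) <;> rfl }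
    refine ⟨_, F.iso_mem (f.union (LGraph.edgeless α) (LGraph.edgeless PUnit.{u + 1}))
      (LGraph.edgeless (Option α)) e (fun x y => ⟨?_, fun h => h.elim⟩) _
      (F.union_mem _ _ f 1 (h inferInstance).one_mem 1 F.single_mem)⟩
    rintro (⟨_, _, h, _⟩ | ⟨_, _, h, _⟩) <;> exact h

/-- A maximal edge set is greatest, because adjoining the image of another subgraph in `F` stays
within `F` and within `G`. -/
theorem exists_isGreatestSubgraph (F : GraphFibration.{u}) {V : Type u} [Finite V]
    (G : LGraph V) : ∃ K : LGraph V, F.IsGreatestSubgraph G K id := by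
  let S : Set (Set (V × V)) :=
    {E | ∃ L : LGraph V, F.Contains L ∧ L.IsEmbedding G id ∧ E = {p | L.Adj p.1 p.2}}
  have hS : S.Nonempty := ⟨_, LGraph.edgeless V, F.contains_edgeless V,
    ⟨Function.injective_id, fun _ _ h => h.elim⟩, rfl⟩
  obtain ⟨E, hE⟩ := S.toFinite.exists_maximal hS
  obtain ⟨K, hK, hKG, rfl⟩ := hE.prop
  refine ⟨K, hK, hKG, fun {U} _ H φ hH hφ => ⟨φ, ⟨hφ.injective, fun x y hxy => ?_⟩, fun _ => rfl⟩⟩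
  have h1 : {p : V × V | (K.supImage H φ).Adj p.1 p.2} ∈ S := by
    refine ⟨_, hK.supImage hH hφ.injective, ⟨Function.injective_id, ?_⟩, rfl⟩
    rintro _ _ (h | ⟨a, b, h, rfl, rfl⟩)
    · exact hKG.map_adj _ _ h
    · exact hφ.map_adj _ _ h
  have h2 := hE.le_of_ge h1 fun p hp => Or.inl hp
  exact h2 (show (φ x, φ y) ∈ {p : V × V | (K.supImage H φ).Adj p.1 p.2} from
    Or.inr ⟨x, y, hxy, rfl, rfl⟩)

/-- Each single vertex of `G` is a subgraph in `F`, so it lies in the image of `ι`. -/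
theorem IsGreatestSubgraph.bijective {V W : Type u} [Finite W] {G : LGraph V} {K : LGraph W}
    {ι : W → V} (h : F.IsGreatestSubgraph G K ι) : Function.Bijective ι := by
  refine ⟨h.isEmbedding.injective, fun x => ?_⟩
  obtain ⟨ψ, -, hψ⟩ := h.greatest (LGraph.edgeless PUnit.{u + 1}) (fun _ => x) ⟨1, F.single_mem⟩
    ⟨fun _ _ _ => rfl, fun _ _ h => h.elim⟩
  exact ⟨_, hψ PUnit.unit⟩

/-! ### The intertwiner spaces given by a graph contained in a fibration -/

theorem exists_permutesInvolutions {W : Type u} [Finite W] {K : LGraph W} (hK : F.Contains K) :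
    ∃ act : K.aut → F.FibreQuotient K →* F.FibreQuotient K,
      PermutesInvolutions (F.quotientGen K) K.aut act := by
  have hle : ∀ σ : K.aut, F.fibreSubgroup K ≤
      (F.fibreSubgroup K).comap (FreeProdZ2.map (σ : Equiv.Perm W)) := by
    intro σ a ha
    rw [Subgroup.mem_comap, hK.mem_fibreSubgroup_iff]
    exact F.iso_mem K K (σ : Equiv.Perm W) (fun x y => (σ.2 x y).symm) a
      (hK.mem_fibreSubgroup_iff.1 ha)
  refine ⟨fun σ => QuotientGroup.map _ _ _ (hle σ), ⟨fun x => ?_, ?_, fun σ x => ?_⟩⟩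
  · rw [quotientGen, ← QuotientGroup.mk_mul, FreeProdZ2.gen_mul_self, QuotientGroup.mk_one]
  · have h1 : Set.range (F.quotientGen K) =
        QuotientGroup.mk' (F.fibreSubgroup K) '' Set.range FreeProdZ2.gen := by
      rw [← Set.range_comp]
      rfl
    rw [h1, ← MonoidHom.map_closure, FreeProdZ2.closure_range_gen, ← MonoidHom.range_eq_map,
      QuotientGroup.range_mk']
  · rw [quotientGen, QuotientGroup.map_mk, FreeProdZ2.map_gen]
    rfl

theorem wordProd_quotientGen (F : GraphFibration.{u}) {W : Type u} [Finite W] (K : LGraph W)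
    {k : ℕ} (m : Fin k → W) :
    wordProd (F.quotientGen K) m = (FreeProdZ2.word m : F.FibreQuotient K) := by
  exact (map_wordProd (QuotientGroup.mk' (F.fibreSubgroup K)) FreeProdZ2.gen m).symm

theorem wordProd_quotientGen_eq_iff {W : Type u} [Finite W] {K : LGraph W} (hK : F.Contains K)
    {k l : ℕ} (a : Fin k → W) (b : Fin l → W) :
    wordProd (F.quotientGen K) a = wordProd (F.quotientGen K) b ↔
      (FreeProdZ2.word a)⁻¹ * FreeProdZ2.word b ∈ F.fibre K := by
  rw [wordProd_quotientGen, wordProd_quotientGen, QuotientGroup.eq, hK.mem_fibreSubgroup_iff]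

end GraphFibration

/-! ### Self-embeddings and automorphisms of finite graphs -/

theorem LGraph.IsEmbedding.exists_aut {W : Type*} [Finite W] {K : LGraph W} {φ : W → W}
    (hφ : K.IsEmbedding K φ) : ∃ σ : K.aut, ((σ : Equiv.Perm W) : W → W) = φ := by
  let σ : Equiv.Perm W := Equiv.ofBijective φ (Finite.injective_iff_bijective.1 hφ.injective)
  have hpow : ∀ (n : ℕ) x y, K.Adj x y → K.Adj ((σ ^ n) x) ((σ ^ n) y) := by
    intro n
    induction n with
    | zero => exact fun x y h => h
    | succ n ih =>
      intro x y h
      rw [pow_succ]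
      exact ih _ _ (hφ.map_adj _ _ h)
  -- In a finite permutation group the inverse is a positive or zero power, so it preserves
  -- adjacency as well.
  have hmem : σ⁻¹ ∈ Submonoid.powers σ :=
    mem_powers_iff_mem_zpowers.2 (inv_mem (Subgroup.mem_zpowers σ))
  obtain ⟨n, hn⟩ := hmem
  refine ⟨⟨σ, fun x y => ⟨fun h => ?_, hφ.map_adj x y⟩⟩, rfl⟩
  have h1 := hpow n _ _ h
  simp only at hn
  rw [hn] at h1
  simpa using h1

theorem LGraph.isEmbedding_aut {W : Type*} {K : LGraph W} (σ : K.aut) :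
    K.IsEmbedding K (σ : Equiv.Perm W) :=
  ⟨(σ : Equiv.Perm W).injective, fun x y h => (σ.2 x y).2 h⟩

theorem LGraph.IsEmbedding.comp {U V W : Type*} {K : LGraph U} {L : LGraph V} {M : LGraph W}
    {ψ : V → W} {φ : U → V} (hψ : L.IsEmbedding M ψ) (hφ : K.IsEmbedding L φ) :
    K.IsEmbedding M (ψ ∘ φ) :=
  ⟨hψ.injective.comp hφ.injective, fun x y h => hψ.map_adj _ _ (hφ.map_adj x y h)⟩

theorem hatT_self {W : Type u} [Finite W] [DecidableEq W] (K : LGraph W) [Fintype K.aut]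
    {k l : ℕ} (b : Fin k → W) (a : Fin l → W) :
    hatT K ⟨W, inferInstance, K, b, a⟩ = orbitMatrix K.aut a b := by
  ext m j
  have h1 : Nat.card {φ : W → W // K.IsEmbedding K φ ∧ φ ∘ b = j ∧ φ ∘ a = m} =
      Nat.card {σ : K.aut // m = (σ : Equiv.Perm W) ∘ a ∧ j = (σ : Equiv.Perm W) ∘ b} := by
    symm
    refine Nat.card_eq_of_bijective (fun σ => ⟨((σ : K.aut) : Equiv.Perm W),
      LGraph.isEmbedding_aut _, σ.2.2.symm, σ.2.1.symm⟩) ⟨fun σ τ h => ?_, ?_⟩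
    · exact Subtype.ext (Subtype.ext (Equiv.coe_fn_injective (Subtype.ext_iff.1 h)))
    · rintro ⟨φ, hφ, hb, ha⟩
      obtain ⟨σ, rfl⟩ := hφ.exists_aut
      exact ⟨⟨σ, ha.symm, hb.symm⟩, rfl⟩
  rw [hatT, h1, orbitMatrix, Finset.sum_boole, Nat.card_eq_fintype_card, Fintype.card_subtype]

/-! ### The spaces spanned by embedding counts -/

namespace GraphFibration

variable {F : GraphFibration.{u}}

/-- Invariance comes from composing embeddings with automorphisms; the support condition holds
because an embedding carries the fibre of the bilabelled graph into that of `K`. -/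
theorem hatT_mem_semidirectMor {W : Type u} [Finite W] {K : LGraph W}
    (hK : F.Contains K) {k l : ℕ} {L : BilabelledGraph.{u} k l} (hL : L ∈ F.category k l) :
    hatT K L ∈ semidirectMor (F.quotientGen K) K.aut k l := by
  refine ⟨fun σ m j => ?_, fun m j hmj => ?_⟩
  · rw [hatT, hatT, Nat.cast_inj]
    symm
    refine Nat.card_eq_of_bijective (fun φ => ⟨(σ : Equiv.Perm W) ∘ φ.1,
      (LGraph.isEmbedding_aut σ).comp φ.2.1, by rw [Function.comp_assoc, φ.2.2.1],
      by rw [Function.comp_assoc, φ.2.2.2]⟩) ⟨fun φ ψ h => ?_, ?_⟩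
    · exact Subtype.ext ((σ : Equiv.Perm W).injective.comp_left (Subtype.ext_iff.1 h))
    · rintro ⟨φ, hφ, hj, hm⟩
      refine ⟨⟨((σ⁻¹ : K.aut) : Equiv.Perm W) ∘ φ, (LGraph.isEmbedding_aut σ⁻¹).comp hφ, ?_, ?_⟩,
        ?_⟩
      · exact ((comp_eq_comp_iff σ _ _).1 hj).symm
      · exact ((comp_eq_comp_iff σ _ _).1 hm).symm
      · refine Subtype.ext (funext fun x => ?_)
        simp
  · have h1 : Nat.card {φ : L.V → W //
        L.graph.IsEmbedding K φ ∧ φ ∘ L.inp = j ∧ φ ∘ L.out = m} ≠ 0 := fun h0 => hmj (by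
      rw [hatT, h0, Nat.cast_zero])
    obtain ⟨⟨φ, hφ, rfl, rfl⟩⟩ := (Nat.card_ne_zero.1 h1).1
    rw [eq_comm, wordProd_quotientGen_eq_iff hK, ← FreeProdZ2.map_word, ← FreeProdZ2.map_word,
      ← map_inv, ← map_mul]
    exact map_mem_fibre hK hφ hL

/-- For the harder inclusion, `T` is averaged into orbit matrices; the one belonging to a nonzero
entry is given by `K` itself, labelled by the two words, and the support condition says that this
labelled graph is in the category. -/
theorem repCategory_eq_semidirectMor {W : Type u} [Finite W] {K : LGraph W}
    (hK : F.Contains K) (k l : ℕ) :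
    repCategory F.category K k l = semidirectMor (F.quotientGen K) K.aut k l := by
  classical
  have := Fintype.ofFinite W
  have := Fintype.ofFinite K.aut
  apply le_antisymm
  · rw [repCategory, Submodule.span_le]
    rintro _ ⟨L, hL, rfl⟩
    exact hatT_mem_semidirectMor hK hL
  · intro T hT
    have h1 := card_smul_eq_sum_orbitMatrix _ _ hT
    have h2 : (Fintype.card K.aut : ℂ) ≠ 0 := Nat.cast_ne_zero.2 Fintype.card_ne_zero
    rw [← inv_smul_smul₀ h2 T, h1]
    refine Submodule.smul_mem _ _ (Submodule.sum_mem _ fun m _ => Submodule.sum_mem _ fun j _ => ?_)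
    by_cases h0 : T m j = 0
    · rw [h0, zero_smul]
      exact zero_mem _
    · refine Submodule.smul_mem _ _ (Submodule.subset_span ?_)
      exact ⟨⟨W, inferInstance, K, j, m⟩,
        (wordProd_quotientGen_eq_iff hK j m).1 (hT.2 m j h0).symm, hatT_self K j m⟩

/-- Every embedding into `G` of a graph in `F` factors uniquely through `K`, so the two counting
matrices agree up to renaming vertices. -/
theorem mem_repCategory_iff {V W : Type u} [Finite W] {G : LGraph V} {K : LGraph W} {e : W ≃ V}
    (hG : F.IsGreatestSubgraph G K e) {k l : ℕ} (T : Matrix (Fin l → V) (Fin k → V) ℂ) :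
    T ∈ repCategory F.category G k l ↔
      T.submatrix (e ∘ ·) (e ∘ ·) ∈ repCategory F.category K k l := by
  have hhat : ∀ L ∈ F.category k l, (hatT G L).submatrix (e ∘ ·) (e ∘ ·) = hatT K L := by
    intro L hL
    ext m j
    rw [Matrix.submatrix_apply, hatT, hatT, Nat.cast_inj]
    symm
    refine Nat.card_eq_of_bijective (fun φ => ⟨e ∘ φ.1, hG.isEmbedding.comp φ.2.1,
      by rw [Function.comp_assoc, φ.2.2.1], by rw [Function.comp_assoc, φ.2.2.2]⟩)
      ⟨fun φ ψ h => ?_, ?_⟩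
    · exact Subtype.ext (e.injective.comp_left (Subtype.ext_iff.1 h))
    · rintro ⟨φ, hφ, hj, hm⟩
      obtain ⟨ψ, hψ, hψφ⟩ := hG.greatest L.graph φ ⟨_, hL⟩ hφ
      obtain rfl : e ∘ ψ = φ := funext hψφ
      exact ⟨⟨ψ, hψ, e.injective.comp_left hj, e.injective.comp_left hm⟩, rfl⟩
  let E : Matrix (Fin l → V) (Fin k → V) ℂ ≃ₗ[ℂ] Matrix (Fin l → W) (Fin k → W) ℂ :=
    Matrix.reindexLinearEquiv ℂ ℂ (Equiv.arrowCongr (Equiv.refl _) e).symm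
      (Equiv.arrowCongr (Equiv.refl _) e).symm
  have hE : ∀ T, E T = T.submatrix (e ∘ ·) (e ∘ ·) := fun T => rfl
  have himg : hatT K '' F.category k l = E '' (hatT G '' F.category k l) := by
    rw [Set.image_image]
    exact Set.image_congr fun L hL => (hhat L hL).symm
  rw [← hE, repCategory, repCategory, himg]
  change _ ↔ _ ∈ Submodule.span ℂ (E.toLinearMap '' _)
  rw [Submodule.span_image]
  exact ((Submodule.mem_map_equiv _).trans (by rw [E.symm_apply_apply])).symm

end GraphFibration

/-! ### The main theorem -/

theorem theoremB (F : GraphFibration.{u}) {V : Type u} [Fintype V] [DecidableEq V]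
    (G : LGraph V) :
    (∃ (W : Type u) (_ : Finite W) (K : LGraph W) (ι : W → V), F.IsGreatestSubgraph G K ι) ∧
    ∀ {W : Type u} [Finite W] [DecidableEq W] (K : LGraph W) (ι : W → V),
      F.IsGreatestSubgraph G K ι →
      ∃ e : W ≃ V, (∀ x, e x = ι x) ∧
        HasRepCategory (Matrix.reindex e e (F.fundamentalRep K)) (repCategory F.category G) ∧
        ∀ {B : Type w} [Ring B] [Algebra ℂ B] [StarRing B] [StarModule ℂ B] (v : Matrix V V B),
          HasRepCategory v (repCategory F.category G) →
          ∃ Φ : SemidirectAlgebra (F.FibreQuotient K) K.aut ≃⋆ₐ[ℂ] B,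
            ∀ i j, Φ (F.fundamentalRep K i j) = v (e i) (e j) := by
  refine ⟨?_, fun {W} _ _ K ι hι => ?_⟩
  · obtain ⟨K, hK⟩ := F.exists_isGreatestSubgraph G
    exact ⟨V, inferInstance, K, id, hK⟩
  have := Fintype.ofFinite W
  have := Fintype.ofFinite K.aut
  obtain ⟨e, rfl⟩ : ∃ e : W ≃ V, e = ι := ⟨Equiv.ofBijective ι hι.bijective, rfl⟩
  have hK := hι.contains
  obtain ⟨act, hact⟩ := GraphFibration.exists_permutesInvolutions hK
  refine ⟨e, fun _ => rfl, ⟨?_, fun k l => ?_⟩, fun {B} _ _ _ _ v hv => ?_⟩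
  · exact hact.isOrthogonalCMQG_semidirectRep.reindex e
  · ext T
    rw [mem_Mor_reindex, GraphFibration.mem_repCategory_iff hι,
      GraphFibration.repCategory_eq_semidirectMor hK]
    rw [GraphFibration.fundamentalRep, PermutesInvolutions.mor_semidirectRep]
  · refine hact.exists_starAlgEquiv (v := Matrix.reindex e.symm e.symm v) (fun k l => ?_)
      (hv.isOrthogonalCMQG.reindex e.symm)
    ext T
    rw [mem_Mor_reindex, hv.mor_eq, GraphFibration.mem_repCategory_iff hι,
      GraphFibration.repCategory_eq_semidirectMor hK, Matrix.submatrix_submatrix]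
    have hs : ∀ k : ℕ, (fun x : Fin k → V => e.symm ∘ x) ∘ (fun x : Fin k → W => e ∘ x) = id :=
      fun k => by ext; simp
    rw [hs, hs, Matrix.submatrix_id_id]
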